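/- **Theorem 1.4.** Let $m>1$ be an integer and let $G$ be either the special pseudo-unitary group $SU(m,m-1)$ (complex $(2m-1)\times(2m-1)$ matrices of determinant $1$ preserving the standard Hermitian form of signature $(m,m-1)$) or the group $SL(2m-1,\mathbb{C})$ regarded as a real Lie group. Let $\mathfrak g=T_1G$ be the real Lie algebra of $G$. Then the Killing form of $\mathfrak g$ is the value at $1$ of a bi-invariant pseudo-Riemannian metric $g$ on $G$, and there are smooth fields $P$, $J$ of endomorphisms of the tangent spaces of $G$ such that: 1. $(P,J)$ is a complex product structure on the manifold $G$, that is, $P^2=1$, $P$ has constant trace, $J^2=-1$, $PJ=-JP$, and for all smooth vector fields $X,Y$ on $G$ $$[PX,PY]+[X,Y]-P[PX,Y]-P[X,PY]=0,$$ $$[JX,JY]-[X,Y]-J[JX,Y]-J[X,JY]=0;$$ 2. $P$ and $J$ are invariant under all left translations of $G$; 3. $g$ is compatible with $(P,J)$, that is, $g(JX,JY)=g(X,Y)$ and $g(PX,PY)=-g(X,Y)$ for all tangent vectors $X,Y$ at any point of $G$. -/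

import Mathlib

open scoped Manifold ContDiff Topology Matrix

noncomputable section

/-! ### Linear Lie groups -/

/-- The data making a topological group `G` a linear Lie group in a finite-dimensional real algebra
`A`: a faithful representation which is a topological embedding, and a real subspace `lie` of `A`
which near `0` consists exactly of the elements whose exponential lies in the image of `G`. -/
structure LinearLieGroup (A : Type*) [NormedRing A] [NormedAlgebra ℝ A]
    (G : Type*) [Group G] [TopologicalSpace G] where
  /-- the representation -/
  incl : G →* A
  isEmbedding : Topology.IsEmbedding incl
  /-- the tangent space at the identity -/
  lie : Submodule ℝ A
  exp_mem_iff : ∀ᶠ X in 𝓝 (0 : A), NormedSpace.exp X ∈ Set.range incl ↔ X ∈ lie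

namespace LinearLieGroup

variable {A : Type*} [NormedRing A] [NormedAlgebra ℝ A] [FiniteDimensional ℝ A]
  {G : Type*} [Group G] [TopologicalSpace G]

theorem contDiff_exp : ContDiff ℝ ω (NormedSpace.exp : A → A) := by
  have := FiniteDimensional.complete ℝ A
  exact AnalyticOnNhd.contDiff (fun x _ => NormedSpace.exp_analytic (𝕂 := ℝ) x)

theorem exists_localExp (D : LinearLieGroup A G) :
    ∃ e : OpenPartialHomeomorph A A, (∀ X, e X = NormedSpace.exp X) ∧ (0 : A) ∈ e.source ∧
      ContDiffOn ℝ ω e.symm e.target ∧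
      ∀ X ∈ e.source, NormedSpace.exp X ∈ Set.range D.incl ↔ X ∈ D.lie := by
  have := FiniteDimensional.complete ℝ A
  have h0 : HasStrictFDerivAt (NormedSpace.exp : A → A)
      ((ContinuousLinearEquiv.refl ℝ A : A ≃L[ℝ] A) : A →L[ℝ] A) 0 :=
    hasStrictFDerivAt_exp_zero
  obtain ⟨U, hU, hUo, h0U⟩ := eventually_nhds_iff.1 D.exp_mem_iff
  let W : Set A := {X | fderiv ℝ (NormedSpace.exp : A → A) X ∈
    Set.range ((↑) : (A ≃L[ℝ] A) → A →L[ℝ] A)}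
  have hWo : IsOpen W := (ContinuousLinearEquiv.isOpen (𝕜 := ℝ) (E := A) (F := A)).preimage
    (contDiff_exp.continuous_fderiv (by simp))
  have h0W : (0 : A) ∈ W := ⟨ContinuousLinearEquiv.refl ℝ A, h0.hasFDerivAt.fderiv.symm⟩
  let e0 := h0.toOpenPartialHomeomorph (NormedSpace.exp : A → A)
  refine ⟨e0.restrOpen (U ∩ W) (hUo.inter hWo), fun X => rfl,
    ⟨h0.mem_toOpenPartialHomeomorph_source, h0U, h0W⟩, ?_, ?_⟩
  · intro a ha
    set e := e0.restrOpen (U ∩ W) (hUo.inter hWo) with he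
    have hs : e.symm a ∈ W := (e.map_target ha).2.2
    obtain ⟨f, hf⟩ := hs
    refine (e.contDiffAt_symm (f₀' := f) ha ?_ contDiff_exp.contDiffAt).contDiffWithinAt
    rw [hf]
    exact (contDiff_exp.differentiable (by simp) _).hasFDerivAt
  · exact fun X hX => hU X hX.2.1

/-- A local inverse of the exponential map: a diffeomorphism between an open neighbourhood of `0`
and an open neighbourhood of `1`, given by the exponential map. -/
def localExp (D : LinearLieGroup A G) : OpenPartialHomeomorph A A :=
  D.exists_localExp.choose

variable (D : LinearLieGroup A G)

theorem localExp_apply (X : A) : D.localExp X = NormedSpace.exp X :=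
  D.exists_localExp.choose_spec.1 X

theorem zero_mem_source : (0 : A) ∈ D.localExp.source := D.exists_localExp.choose_spec.2.1

theorem contDiffOn_localExp_symm : ContDiffOn ℝ ω D.localExp.symm D.localExp.target :=
  D.exists_localExp.choose_spec.2.2.1

theorem exp_mem_range_iff {X : A} (hX : X ∈ D.localExp.source) :
    NormedSpace.exp X ∈ Set.range D.incl ↔ X ∈ D.lie :=
  D.exists_localExp.choose_spec.2.2.2 X hX

theorem one_mem_target : (1 : A) ∈ D.localExp.target := by
  have := D.localExp.map_source D.zero_mem_source
  rwa [D.localExp_apply, NormedSpace.exp_zero] at this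

theorem exists_proj : ∃ p : A →L[ℝ] D.lie, ∀ X : D.lie, p X = X := by
  have : FiniteDimensional ℝ (A ⧸ D.lie) := inferInstance
  exact Submodule.ClosedComplemented.of_finiteDimensional_quotient
    (Submodule.closed_of_finiteDimensional D.lie)

/-- A linear projection of `A` onto `lie`. In the charts below it is only ever applied to elements
of `lie`, so its choice does not matter. -/
def proj : A →L[ℝ] D.lie := D.exists_proj.choose

theorem proj_coe (X : D.lie) : D.proj X = X := D.exists_proj.choose_spec X

theorem symm_incl_mem {x : G} (hx : D.incl x ∈ D.localExp.target) :
    D.localExp.symm (D.incl x) ∈ D.lie := by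
  rw [← D.exp_mem_range_iff (D.localExp.map_target hx), ← D.localExp_apply,
    D.localExp.right_inv hx]
  exact ⟨x, rfl⟩

theorem coe_proj_symm_incl {x : G} (hx : D.incl x ∈ D.localExp.target) :
    (D.proj (D.localExp.symm (D.incl x)) : A) = D.localExp.symm (D.incl x) :=
  congrArg Subtype.val (D.proj_coe ⟨_, D.symm_incl_mem hx⟩)

theorem incl_invFun {X : D.lie} (hX : (X : A) ∈ D.localExp.source) :
    D.incl (Function.invFun D.incl (NormedSpace.exp (X : A))) = NormedSpace.exp (X : A) :=
  Function.invFun_eq ((D.exp_mem_range_iff hX).2 X.2)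

variable [IsTopologicalGroup G]

/-- The logarithmic chart of `G` at `g`: the inverse of `X ↦ g * exp X`, for `X` in `lie` near
`0`. -/
def chart (g : G) : OpenPartialHomeomorph G D.lie where
  toFun h := D.proj (D.localExp.symm (D.incl (g⁻¹ * h)))
  invFun X := g * Function.invFun D.incl (NormedSpace.exp (X : A))
  source := {h | D.incl (g⁻¹ * h) ∈ D.localExp.target}
  target := {X | (X : A) ∈ D.localExp.source}
  map_source' h hh := by
    simp only [Set.mem_ofPred_eq] at hh ⊢
    rw [D.coe_proj_symm_incl hh]
    exact D.localExp.map_target hh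
  map_target' X hX := by
    simp only [Set.mem_ofPred_eq, inv_mul_cancel_left] at hX ⊢
    rw [D.incl_invFun hX, ← D.localExp_apply]
    exact D.localExp.map_source hX
  left_inv' h hh := by
    simp only [Set.mem_ofPred_eq] at hh
    rw [D.coe_proj_symm_incl hh, ← D.localExp_apply, D.localExp.right_inv hh,
      Function.leftInverse_invFun D.isEmbedding.injective, mul_inv_cancel_left]
  right_inv' X hX := by
    simp only [Set.mem_ofPred_eq, inv_mul_cancel_left] at hX ⊢
    rw [D.incl_invFun hX, ← D.localExp_apply, D.localExp.left_inv hX, D.proj_coe]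
  open_source := D.localExp.open_target.preimage
    (D.isEmbedding.continuous.comp (continuous_const.mul continuous_id))
  open_target := D.localExp.open_source.preimage continuous_subtype_val
  continuousOn_toFun := D.proj.continuous.comp_continuousOn
    (D.localExp.continuousOn_symm.comp
      (D.isEmbedding.continuous.comp (continuous_const.mul continuous_id)).continuousOn
      fun _ hh => hh)
  continuousOn_invFun := by
    refine continuousOn_const.mul ?_
    rw [D.isEmbedding.isInducing.continuousOn_iff]
    exact (contDiff_exp.continuous.comp continuous_subtype_val).continuousOn.congr
      fun X hX => D.incl_invFun hX

theorem mem_chart_source (g : G) : g ∈ (D.chart g).source := by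
  change D.incl (g⁻¹ * g) ∈ D.localExp.target
  rw [inv_mul_cancel, map_one]
  exact D.one_mem_target

/-- The atlas of logarithmic charts. -/
@[reducible] def chartedSpace : ChartedSpace D.lie G where
  atlas := Set.range D.chart
  chartAt := D.chart
  mem_chart_source := D.mem_chart_source
  chart_mem_atlas g := ⟨g, rfl⟩

theorem incl_chart_symm (g : G) {X : D.lie} (hX : X ∈ (D.chart g).target) :
    D.incl ((D.chart g).symm X) = D.incl g * NormedSpace.exp (X : A) := by
  change D.incl (g * _) = _
  rw [map_mul, D.incl_invFun hX]

theorem isManifold : letI := D.chartedSpace; IsManifold 𝓘(ℝ, D.lie) ω G := by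
  let _ := D.chartedSpace
  refine isManifold_of_contDiffOn _ _ _ ?_
  rintro _ _ ⟨g, rfl⟩ ⟨k, rfl⟩
  simp only [modelWithCornersSelf_coe, modelWithCornersSelf_coe_symm, Function.id_comp,
    Function.comp_id, Set.preimage_id, Set.range_id, Set.inter_univ]
  have h1 : ContDiffOn ℝ ω (fun X : D.lie => D.proj (D.localExp.symm
      (D.incl (k⁻¹ * g) * NormedSpace.exp (X : A)))) ((D.chart g).symm ≫ₕ D.chart k).source := by
    refine D.proj.contDiff.comp_contDiffOn (D.contDiffOn_localExp_symm.comp ?_ ?_)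
    · exact (contDiff_const.mul (contDiff_exp.comp D.lie.subtypeL.contDiff)).contDiffOn
    · intro X hX
      have hX2 : D.incl (k⁻¹ * (D.chart g).symm X) ∈ D.localExp.target := hX.2
      rwa [map_mul, D.incl_chart_symm g hX.1, ← mul_assoc, ← map_mul] at hX2
  refine h1.congr fun X hX => ?_
  change D.proj (D.localExp.symm (D.incl (k⁻¹ * (D.chart g).symm X))) = _
  rw [map_mul, D.incl_chart_symm g hX.1, ← mul_assoc, ← map_mul]

theorem contMDiff_incl : letI := D.chartedSpace; ContMDiff 𝓘(ℝ, D.lie) 𝓘(ℝ, A) ω D.incl := by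
  let _ := D.chartedSpace
  have := D.isManifold
  intro g
  have h1 : ContMDiffAt 𝓘(ℝ, D.lie) 𝓘(ℝ, D.lie) ω (D.chart g) g :=
    (contMDiffOn_chart (I := 𝓘(ℝ, D.lie)) (n := ω) (x := g)).contMDiffAt
      ((D.chart g).open_source.mem_nhds (D.mem_chart_source g))
  have h2 : ContDiff ℝ ω (fun X : D.lie => D.incl g * NormedSpace.exp (X : A)) :=
    contDiff_const.mul (contDiff_exp.comp D.lie.subtypeL.contDiff)
  refine (h2.contMDiff.contMDiffAt.comp g h1).congr_of_eventuallyEq ?_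
  filter_upwards [(D.chart g).open_source.mem_nhds (D.mem_chart_source g)] with h hh
  rw [Function.comp_apply, ← D.incl_chart_symm g ((D.chart g).map_source hh),
    (D.chart g).left_inv hh]

/-- A continuous map into `G` is smooth as soon as its composition with the representation is. -/
theorem contMDiffAt_of_incl {F H M : Type*} [NormedAddCommGroup F] [NormedSpace ℝ F]
    [TopologicalSpace H] {I : ModelWithCorners ℝ F H} [TopologicalSpace M] [ChartedSpace H M]
    {f : M → G} {x : M} (hf : ContinuousAt f x)
    (hs : ContMDiffAt I 𝓘(ℝ, A) ω (fun y => D.incl (f y)) x) :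
    letI := D.chartedSpace; ContMDiffAt I 𝓘(ℝ, D.lie) ω f x := by
  let _ := D.chartedSpace
  have := D.isManifold
  rw [contMDiffAt_iff_target]
  refine ⟨hf, ?_⟩
  have h1 : ContMDiffAt I 𝓘(ℝ, A) ω (fun y => D.incl (f x)⁻¹ * D.incl (f y)) x :=
    (contDiff_const.mul contDiff_id : ContDiff ℝ ω
      (fun a : A => D.incl (f x)⁻¹ * a)).contMDiff.contMDiffAt.comp x hs
  have h2 : ContDiffAt ℝ ω (fun a => D.proj (D.localExp.symm a))
      (D.incl (f x)⁻¹ * D.incl (f x)) := by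
    rw [← map_mul, inv_mul_cancel, map_one]
    exact D.proj.contDiff.contDiffAt.comp _ (D.contDiffOn_localExp_symm.contDiffAt
      (D.localExp.open_target.mem_nhds D.one_mem_target))
  refine (ContMDiffAt.comp x h2.contMDiffAt h1).congr_of_eventuallyEq
    (Filter.Eventually.of_forall fun y => ?_)
  change D.proj (D.localExp.symm (D.incl ((f x)⁻¹ * f y))) = _
  rw [map_mul]
  rfl

theorem lieGroup : letI := D.chartedSpace; LieGroup 𝓘(ℝ, D.lie) ω G := by
  let _ := D.chartedSpace
  have := D.isManifold
  have := FiniteDimensional.complete ℝ A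
  have hi := D.contMDiff_incl
  refine { contMDiff_mul := fun p => ?_, contMDiff_inv := fun g => ?_ }
  · refine D.contMDiffAt_of_incl continuous_mul.continuousAt ?_
    have h1 : ContMDiffAt (𝓘(ℝ, D.lie).prod 𝓘(ℝ, D.lie)) 𝓘(ℝ, A × A) ω
        (fun q : G × G => (D.incl q.1, D.incl q.2)) p :=
      (hi.comp contMDiff_fst).contMDiffAt.prodMk_space (hi.comp contMDiff_snd).contMDiffAt
    have h2 := ((contDiff_fst.mul contDiff_snd : ContDiff ℝ ω
      (fun q : A × A => q.1 * q.2)).contMDiff.contMDiffAt).comp p h1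
    simpa [Function.comp_def] using h2
  · refine D.contMDiffAt_of_incl continuous_inv.continuousAt ?_
    let u : G → Aˣ := fun x =>
      ⟨D.incl x, D.incl x⁻¹, by rw [← map_mul]; simp, by rw [← map_mul]; simp⟩
    have h1 : (fun y => D.incl y⁻¹) = fun y => Ring.inverse (D.incl y) := by
      funext y
      exact (Ring.inverse_unit (u y)).symm
    rw [h1]
    exact ((contDiffAt_ringInverse ℝ (u g)).contMDiffAt).comp g hi.contMDiffAt

end LinearLieGroup


/-! ### The matrix exponential -/

section MatrixExp

open scoped Matrix.Norms.Operator

variable {n : Type*} [Fintype n] [DecidableEq n]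

theorem differentiable_det : Differentiable ℝ (fun M : Matrix n n ℂ => M.det) := by
  simp only [Matrix.det_apply]
  refine Differentiable.fun_sum fun σ _ => Differentiable.const_smul ?_ _
  have h : ∀ i, Differentiable ℝ fun M : Matrix n n ℂ => M (σ i) i := fun i =>
    (LinearMap.toContinuousLinearMap (Matrix.entryLinearMap ℝ ℂ (σ i) i)).differentiable
  fun_prop

theorem det_exp (X : Matrix n n ℂ) :
    (NormedSpace.exp X).det = Complex.exp X.trace := by
  have he : ∀ t : ℝ, HasDerivAt (fun s : ℝ => NormedSpace.exp (s • X))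
      (NormedSpace.exp (t • X) * X) t := fun t => hasDerivAt_exp_smul_const X t
  have hd : ∀ M : Matrix n n ℂ, HasFDerivAt (fun M : Matrix n n ℂ => M.det)
      (fderiv ℝ (fun M : Matrix n n ℂ => M.det) M) M :=
    fun M => (differentiable_det (n := n) M).hasFDerivAt
  have hlin : HasDerivAt (fun s : ℝ => (1 + s • X).det) X.trace 0 := by
    have hpoly : ∀ s : ℝ, (1 + s • X).det
        = ((1 + (Polynomial.X : Polynomial ℂ) • X.map Polynomial.C).det).eval (s : ℂ) := by
      intro s
      rw [← Polynomial.coe_evalRingHom, RingHom.map_det]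
      congr 1
      ext i j
      rw [RingHom.mapMatrix_apply, Matrix.map_apply, Matrix.add_apply, Matrix.add_apply,
        Matrix.smul_apply, Matrix.smul_apply, Matrix.map_apply, map_add, smul_eq_mul, map_mul]
      simp [Matrix.one_apply, apply_ite]
    simp only [hpoly]
    have h := (((1 + (Polynomial.X : Polynomial ℂ) • X.map Polynomial.C).det).hasDerivAt
      (((0 : ℝ) : ℂ))).comp_ofReal
    rwa [Complex.ofReal_zero, Matrix.derivative_det_one_add_X_smul] at h
  have h0 : HasDerivAt (fun s : ℝ => (NormedSpace.exp (s • X)).det) X.trace 0 := by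
    have he0 : HasDerivAt (fun s : ℝ => NormedSpace.exp (s • X)) X 0 := by
      have := he 0
      rwa [zero_smul, NormedSpace.exp_zero, one_mul] at this
    have hl : HasDerivAt (fun s : ℝ => 1 + s • X) X 0 := by
      have := ((hasDerivAt_id (0 : ℝ)).smul_const X).const_add 1
      rwa [one_smul] at this
    have a1 : HasDerivAt (fun s : ℝ => (1 + s • X).det)
        (fderiv ℝ (fun M : Matrix n n ℂ => M.det) (1 + (0 : ℝ) • X) X) 0 :=
      HasFDerivAt.comp_hasDerivAt (0 : ℝ) (hd _) hl
    have a2 : HasDerivAt (fun s : ℝ => (NormedSpace.exp (s • X)).det)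
        (fderiv ℝ (fun M : Matrix n n ℂ => M.det) (NormedSpace.exp ((0 : ℝ) • X)) X) 0 :=
      HasFDerivAt.comp_hasDerivAt (0 : ℝ) (hd _) he0
    have e1 : (1 + (0 : ℝ) • X) = 1 := by rw [zero_smul, add_zero]
    have e2 : NormedSpace.exp ((0 : ℝ) • X) = 1 := by rw [zero_smul, NormedSpace.exp_zero]
    rw [e1] at a1
    rw [e2] at a2
    rwa [a1.unique hlin] at a2
  have hder : ∀ t : ℝ, HasDerivAt (fun s : ℝ => (NormedSpace.exp (s • X)).det)
      ((NormedSpace.exp (t • X)).det * X.trace) t := by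
    intro t
    have h1 : (fun s : ℝ => (NormedSpace.exp (s • X)).det) =
        fun s => (NormedSpace.exp (t • X)).det * (NormedSpace.exp ((s - t) • X)).det := by
      funext s
      rw [← Matrix.det_mul, ← Matrix.exp_add_of_commute]
      · rw [← add_smul]; congr 3; ring
      · exact ((Commute.refl X).smul_left t).smul_right (s - t)
    rw [h1]
    refine HasDerivAt.const_mul _ ?_
    have h2 : HasDerivAt (fun s : ℝ => (NormedSpace.exp (s • X)).det) X.trace (t - t) := by
      rw [sub_self]; exact h0
    exact h2.comp_sub_const t t
  have hg : ∀ t : ℝ, HasDerivAt (fun s : ℝ => (NormedSpace.exp (s • X)).det *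
      Complex.exp (-(s * X.trace))) 0 t := by
    intro t
    have h3 : HasDerivAt (fun s : ℝ => Complex.exp (-(s * X.trace)))
        (Complex.exp (-(t * X.trace)) * (-(1 * X.trace))) t :=
      (((Complex.ofRealCLM.hasDerivAt (x := t)).mul_const X.trace).neg).cexp
    convert! (hder t).mul h3 using 1
    ring
  have hc := is_const_of_deriv_eq_zero (fun t => (hg t).differentiableAt)
    (fun t => (hg t).deriv) 1 0
  simp only [one_smul, zero_smul, NormedSpace.exp_zero, Matrix.det_one, Complex.ofReal_one,
    Complex.ofReal_zero, one_mul, zero_mul, neg_zero, Complex.exp_zero, Complex.exp_neg] at hc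
  field_simp at hc
  exact hc

theorem eventually_det_exp_iff :
    ∀ᶠ X in 𝓝 (0 : Matrix n n ℂ), (NormedSpace.exp X).det = 1 ↔ X.trace = 0 := by
  have hc : Continuous fun X : Matrix n n ℂ => ‖X.trace‖ := continuous_id.matrix_trace.norm
  have hb : ‖(0 : Matrix n n ℂ).trace‖ < 2 * Real.pi := by simpa using Real.pi_pos
  filter_upwards [(hc.tendsto 0).eventually (gt_mem_nhds hb)] with X hX
  rw [det_exp, Complex.exp_eq_one_iff]
  refine ⟨?_, fun h => ⟨0, by simpa using h⟩⟩
  rintro ⟨k, hk⟩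
  rw [hk] at hX ⊢
  have hk0 : k = 0 := by
    by_contra hne
    have h1 : (1 : ℝ) ≤ |(k : ℝ)| := by exact_mod_cast Int.one_le_abs hne
    simp only [norm_mul, Complex.norm_intCast, Complex.norm_ofNat, Complex.norm_real,
      Real.norm_eq_abs, abs_of_pos Real.pi_pos, Complex.norm_I, mul_one] at hX
    nlinarith [Real.pi_pos]
  simp [hk0]
theorem eventually_exp_injective :
    ∃ U : Set (Matrix n n ℂ), IsOpen U ∧ (0 : Matrix n n ℂ) ∈ U ∧
      Set.InjOn NormedSpace.exp U := by
  have h0 : HasStrictFDerivAt (NormedSpace.exp : Matrix n n ℂ → Matrix n n ℂ)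
      ((ContinuousLinearEquiv.refl ℝ (Matrix n n ℂ) : Matrix n n ℂ ≃L[ℝ] Matrix n n ℂ) :
        Matrix n n ℂ →L[ℝ] Matrix n n ℂ) 0 := hasStrictFDerivAt_exp_zero
  exact ⟨_, (h0.toOpenPartialHomeomorph NormedSpace.exp).open_source,
    h0.mem_toOpenPartialHomeomorph_source, (h0.toOpenPartialHomeomorph NormedSpace.exp).injOn⟩

end MatrixExp

/-! ### The groups `SL(n, ℂ)`, regarded as a real Lie group, and `SU(p, q)` -/

section Groups

/-- The Hermitian form of signature `(p, q)`: the diagonal matrix with `p` entries `1` and `q`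
entries `-1`. -/
abbrev signatureForm (p q : ℕ) : Matrix (Fin p ⊕ Fin q) (Fin p ⊕ Fin q) ℂ :=
  LieAlgebra.Orthogonal.indefiniteDiagonal (Fin p) (Fin q) ℂ

theorem signatureForm_mul_self (p q : ℕ) : signatureForm p q * signatureForm p q = 1 := by
  rw [signatureForm, LieAlgebra.Orthogonal.indefiniteDiagonal, Matrix.diagonal_mul_diagonal,
    ← Matrix.diagonal_one]
  congr 1
  funext i
  cases i <;> simp

/-- The special pseudo-unitary group `SU(p, q)`: complex matrices of determinant `1` which preserve
the standard Hermitian form of signature `(p, q)`. -/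
def SU (p q : ℕ) : Subgroup (Matrix.SpecialLinearGroup (Fin p ⊕ Fin q) ℂ) where
  carrier := {g | (g : Matrix _ _ ℂ)ᴴ * signatureForm p q * (g : Matrix _ _ ℂ) = signatureForm p q}
  mul_mem' {g h} hg hh := by
    simp only [Set.mem_ofPred_eq, Matrix.SpecialLinearGroup.coe_mul, Matrix.conjTranspose_mul] at hg hh ⊢
    calc _ = (h : Matrix _ _ ℂ)ᴴ * ((g : Matrix _ _ ℂ)ᴴ * signatureForm p q *
          (g : Matrix _ _ ℂ)) * (h : Matrix _ _ ℂ) := by simp only [Matrix.mul_assoc]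
      _ = _ := by rw [hg, hh]
  one_mem' := by simp
  inv_mem' {g} hg := by
    simp only [Set.mem_ofPred_eq] at hg ⊢
    have h1 : (g : Matrix (Fin p ⊕ Fin q) (Fin p ⊕ Fin q) ℂ) * (g⁻¹).1 = 1 := by
      rw [← Matrix.SpecialLinearGroup.coe_mul, mul_inv_cancel, Matrix.SpecialLinearGroup.coe_one]
    have h2 : (g⁻¹).1ᴴ * (g : Matrix (Fin p ⊕ Fin q) (Fin p ⊕ Fin q) ℂ)ᴴ = 1 := by
      rw [← Matrix.conjTranspose_mul, h1, Matrix.conjTranspose_one]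
    calc (g⁻¹).1ᴴ * signatureForm p q * (g⁻¹).1
        = (g⁻¹).1ᴴ * ((g : Matrix _ _ ℂ)ᴴ * signatureForm p q * (g : Matrix _ _ ℂ)) * (g⁻¹).1 := by
          rw [hg]
      _ = ((g⁻¹).1ᴴ * (g : Matrix _ _ ℂ)ᴴ) * signatureForm p q *
          ((g : Matrix _ _ ℂ) * (g⁻¹).1) := by simp only [Matrix.mul_assoc]
      _ = _ := by rw [h1, h2, Matrix.one_mul, Matrix.mul_one]

theorem exp_preserves_iff {p q : ℕ} (X : Matrix (Fin p ⊕ Fin q) (Fin p ⊕ Fin q) ℂ) :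
    (NormedSpace.exp X)ᴴ * signatureForm p q * NormedSpace.exp X = signatureForm p q ↔
      NormedSpace.exp (signatureForm p q * Xᴴ * signatureForm p q) = NormedSpace.exp (-X) := by
  have hs := signatureForm_mul_self p q
  have hinv : (signatureForm p q)⁻¹ = signatureForm p q := Matrix.inv_eq_left_inv hs
  have hu : IsUnit (signatureForm p q) := ⟨⟨_, _, hs, hs⟩, rfl⟩
  have h1 := Matrix.exp_conj (signatureForm p q) Xᴴ hu
  have hX := Matrix.isUnit_exp X
  rw [hinv] at h1
  rw [h1, Matrix.exp_neg, Matrix.exp_conjTranspose]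
  have h2 : NormedSpace.exp X * (NormedSpace.exp X)⁻¹ = 1 :=
    Matrix.mul_nonsing_inv _ ((Matrix.isUnit_iff_isUnit_det _).1 hX)
  have h3 : (NormedSpace.exp X)⁻¹ * NormedSpace.exp X = 1 :=
    Matrix.nonsing_inv_mul _ ((Matrix.isUnit_iff_isUnit_det _).1 hX)
  constructor
  · intro h
    calc signatureForm p q * (NormedSpace.exp X)ᴴ * signatureForm p q
        = signatureForm p q * ((NormedSpace.exp X)ᴴ * signatureForm p q * NormedSpace.exp X) *
          (NormedSpace.exp X)⁻¹ := by simp only [Matrix.mul_assoc, h2, Matrix.mul_one]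
      _ = _ := by rw [h, hs, Matrix.one_mul]
  · intro h
    calc (NormedSpace.exp X)ᴴ * signatureForm p q * NormedSpace.exp X
        = signatureForm p q * (signatureForm p q * (NormedSpace.exp X)ᴴ * signatureForm p q) *
          NormedSpace.exp X := by simp only [← Matrix.mul_assoc, hs, Matrix.one_mul]
      _ = _ := by rw [h, Matrix.mul_assoc, h3, Matrix.mul_one]

theorem skew_iff {p q : ℕ} (X : Matrix (Fin p ⊕ Fin q) (Fin p ⊕ Fin q) ℂ) :
    signatureForm p q * Xᴴ * signatureForm p q = -X ↔
      Xᴴ * signatureForm p q + signatureForm p q * X = 0 := by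
  have hs := signatureForm_mul_self p q
  constructor
  · intro h
    have : Xᴴ * signatureForm p q =
        signatureForm p q * (signatureForm p q * Xᴴ * signatureForm p q) := by
      simp only [← Matrix.mul_assoc, hs, Matrix.one_mul]
    rw [this, h, Matrix.mul_neg, neg_add_cancel]
  · intro h
    rw [Matrix.mul_assoc, eq_neg_of_add_eq_zero_left h, Matrix.mul_neg, ← Matrix.mul_assoc, hs,
      Matrix.one_mul]

theorem su_add {p q : ℕ} {X Y : Matrix (Fin p ⊕ Fin q) (Fin p ⊕ Fin q) ℂ}
    (hX : Xᴴ * signatureForm p q + signatureForm p q * X = 0 ∧ X.trace = 0)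
    (hY : Yᴴ * signatureForm p q + signatureForm p q * Y = 0 ∧ Y.trace = 0) :
    (X + Y)ᴴ * signatureForm p q + signatureForm p q * (X + Y) = 0 ∧ (X + Y).trace = 0 := by
  refine ⟨?_, by rw [Matrix.trace_add, hX.2, hY.2, add_zero]⟩
  rw [Matrix.conjTranspose_add, Matrix.add_mul, Matrix.mul_add, add_add_add_comm, hX.1, hY.1,
    add_zero]

theorem su_zero (p q : ℕ) :
    (0 : Matrix (Fin p ⊕ Fin q) (Fin p ⊕ Fin q) ℂ)ᴴ * signatureForm p q + signatureForm p q * 0 = 0 ∧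
      (0 : Matrix (Fin p ⊕ Fin q) (Fin p ⊕ Fin q) ℂ).trace = 0 := by
  simp

theorem su_smul {p q : ℕ} {X : Matrix (Fin p ⊕ Fin q) (Fin p ⊕ Fin q) ℂ} (c : ℝ)
    (hX : Xᴴ * signatureForm p q + signatureForm p q * X = 0 ∧ X.trace = 0) :
    (c • X)ᴴ * signatureForm p q + signatureForm p q * (c • X) = 0 ∧ (c • X).trace = 0 := by
  refine ⟨?_, by rw [Matrix.trace_smul, hX.2, smul_zero]⟩
  rw [Matrix.conjTranspose_smul, star_trivial, Matrix.smul_mul, Matrix.mul_smul, ← smul_add,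
    hX.1, smul_zero]

theorem eventually_exp_mem_iff (p q : ℕ) :
    ∀ᶠ X in 𝓝 (0 : Matrix (Fin p ⊕ Fin q) (Fin p ⊕ Fin q) ℂ),
      ((NormedSpace.exp X)ᴴ * signatureForm p q * NormedSpace.exp X = signatureForm p q ∧
        (NormedSpace.exp X).det = 1) ↔
      (Xᴴ * signatureForm p q + signatureForm p q * X = 0 ∧ X.trace = 0) := by
  obtain ⟨U, hUo, h0U, hU⟩ := eventually_exp_injective (n := Fin p ⊕ Fin q)
  have c1 : Continuous fun X : Matrix (Fin p ⊕ Fin q) (Fin p ⊕ Fin q) ℂ =>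
      signatureForm p q * Xᴴ * signatureForm p q :=
    (continuous_const.matrix_mul continuous_id.matrix_conjTranspose).matrix_mul continuous_const
  have c2 : Continuous fun X : Matrix (Fin p ⊕ Fin q) (Fin p ⊕ Fin q) ℂ => -X := continuous_neg
  filter_upwards [eventually_det_exp_iff (n := Fin p ⊕ Fin q),
    c1.continuousAt.preimage_mem_nhds (hUo.mem_nhds (by simpa using h0U)),
    c2.continuousAt.preimage_mem_nhds (hUo.mem_nhds (by simpa using h0U))] with X hX h1 h2
  rw [hX, exp_preserves_iff, ← skew_iff, hU.eq_iff h1 h2]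

/-- The algebra of complex matrices, as a real normed algebra for the `ℓ^∞` operator norm. -/
def MatAlg (n : Type*) : Type _ := Matrix n n ℂ

variable {n : Type*} [Fintype n] [DecidableEq n]

variable (n) in
/-- The normed ring structure of `MatAlg n`. -/
def MatAlg.normedRing : NormedRing (MatAlg n) :=
  (Matrix.linftyOpNormedRing : NormedRing (Matrix n n ℂ))

instance : NormedRing (MatAlg n) := MatAlg.normedRing n

instance : NormedAlgebra ℝ (MatAlg n) :=
  letI : SeminormedRing (Matrix n n ℂ) := Matrix.linftyOpSemiNormedRing
  (Matrix.linftyOpNormedAlgebra : NormedAlgebra ℝ (Matrix n n ℂ))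

instance : FiniteDimensional ℝ (MatAlg n) :=
  (inferInstance : FiniteDimensional ℝ (Matrix n n ℂ))

variable (n) in
/-- `sl(n, ℂ)` as a real vector space: the trace-free complex matrices. -/
def slReal : Submodule ℝ (MatAlg n) where
  carrier := {X : Matrix n n ℂ | X.trace = 0}
  add_mem' {X Y} hX hY := by
    have hX' : Matrix.trace (X : Matrix n n ℂ) = 0 := hX
    have hY' : Matrix.trace (Y : Matrix n n ℂ) = 0 := hY
    exact (Matrix.trace_add _ _).trans (by rw [hX', hY', add_zero])
  zero_mem' := Matrix.trace_zero n ℂ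
  smul_mem' c X hX := by
    have hX' : Matrix.trace (X : Matrix n n ℂ) = 0 := hX
    exact (Matrix.trace_smul c (X : Matrix n n ℂ)).trans (by rw [hX', smul_zero])

variable (n) in
/-- `SL(n, ℂ)` as a linear Lie group over `ℝ`. -/
def slRealLinear : LinearLieGroup (MatAlg n) (Matrix.SpecialLinearGroup n ℂ) where
  incl := { toFun := fun g => (g : Matrix n n ℂ), map_one' := rfl, map_mul' := fun _ _ => rfl }
  isEmbedding := Topology.IsEmbedding.subtypeVal
  lie := slReal n
  exp_mem_iff := (eventually_det_exp_iff (n := n)).mono fun X hX =>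
    Iff.trans ⟨fun ⟨g, hg⟩ => (congrArg Matrix.det hg).symm.trans g.2,
      fun h => ⟨⟨NormedSpace.exp X, h⟩, rfl⟩⟩ hX

instance : ChartedSpace (slReal n) (Matrix.SpecialLinearGroup n ℂ) :=
  (slRealLinear n).chartedSpace

instance : LieGroup 𝓘(ℝ, slReal n) ω (Matrix.SpecialLinearGroup n ℂ) := (slRealLinear n).lieGroup

/-- `su(p, q)`: the trace-free complex matrices which are skew-adjoint for the standard Hermitian
form of signature `(p, q)`. -/
def suReal (p q : ℕ) : Submodule ℝ (MatAlg (Fin p ⊕ Fin q)) where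
  carrier := {X : Matrix (Fin p ⊕ Fin q) (Fin p ⊕ Fin q) ℂ |
    Xᴴ * signatureForm p q + signatureForm p q * X = 0 ∧ X.trace = 0}
  add_mem' hX hY := su_add hX hY
  zero_mem' := su_zero p q
  smul_mem' c _ hX := su_smul c hX

/-- `SU(p, q)` as a linear Lie group. -/
def suLinear (p q : ℕ) : LinearLieGroup (MatAlg (Fin p ⊕ Fin q)) (SU p q) where
  incl := { toFun := fun g => (g.1 : Matrix _ _ ℂ), map_one' := rfl, map_mul' := fun _ _ => rfl }
  isEmbedding := (slRealLinear (Fin p ⊕ Fin q)).isEmbedding.comp Topology.IsEmbedding.subtypeVal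
  lie := suReal p q
  exp_mem_iff := (eventually_exp_mem_iff p q).mono fun X hX => by
    refine Iff.trans ⟨?_, fun h => ⟨⟨⟨NormedSpace.exp X, h.2⟩, h.1⟩, rfl⟩⟩ hX
    rintro ⟨g, hg⟩
    have h2 : (g.1 : Matrix _ _ ℂ) =
      NormedSpace.exp (X : Matrix (Fin p ⊕ Fin q) (Fin p ⊕ Fin q) ℂ) := hg
    rw [← h2]
    exact ⟨g.2, g.1.2⟩

instance (p q : ℕ) : ChartedSpace (suReal p q) (SU p q) := (suLinear p q).chartedSpace

instance (p q : ℕ) : LieGroup 𝓘(ℝ, suReal p q) ω (SU p q) := (suLinear p q).lieGroup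

end Groups

/-! ### Complex product structures and compatible metrics -/

section Geometry

open Bundle VectorField

variable {E : Type*} [NormedAddCommGroup E] [NormedSpace ℝ E]
  {H : Type*} [TopologicalSpace H] (I : ModelWithCorners ℝ E H)
  (M : Type*) [TopologicalSpace M] [ChartedSpace H M] [IsManifold I ∞ M]

/-- A smooth field of endomorphisms of the tangent spaces of `M`. -/
structure EndomorphismField where
  toFun : ∀ x : M, TangentSpace I x →L[ℝ] TangentSpace I x
  contMDiff : ContMDiff I (I.prod 𝓘(ℝ, E →L[ℝ] E)) ∞
    (fun x => TotalSpace.mk' (E →L[ℝ] E)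
      (E := fun x : M => TangentSpace I x →L[ℝ] TangentSpace I x) x (toFun x))

/-- A pseudo-Riemannian metric on `M`: a smooth field of nondegenerate symmetric bilinear forms on
the tangent spaces. -/
structure PseudoRiemannianMetric where
  toFun : ∀ x : M, TangentSpace I x →L[ℝ] TangentSpace I x →L[ℝ] ℝ
  contMDiff : ContMDiff I (I.prod 𝓘(ℝ, E →L[ℝ] E →L[ℝ] ℝ)) ∞
    (fun x => TotalSpace.mk' (E →L[ℝ] E →L[ℝ] ℝ)
      (E := fun x : M => TangentSpace I x →L[ℝ] TangentSpace I x →L[ℝ] ℝ) x (toFun x))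
  symm : ∀ (x : M) (v w : TangentSpace I x), toFun x v w = toFun x w v
  nondegenerate : ∀ (x : M) (v : TangentSpace I x), (∀ w, toFun x v w = 0) → v = 0

variable {I M}

instance : CoeFun (EndomorphismField I M)
    fun _ => ∀ x : M, TangentSpace I x →L[ℝ] TangentSpace I x := ⟨EndomorphismField.toFun⟩

instance : CoeFun (PseudoRiemannianMetric I M)
    fun _ => ∀ x : M, TangentSpace I x →L[ℝ] TangentSpace I x →L[ℝ] ℝ :=
  ⟨PseudoRiemannianMetric.toFun⟩

/-- `X` is a smooth vector field on `M`. -/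
def IsSmoothVectorField (X : ∀ x : M, TangentSpace I x) : Prop :=
  ContMDiff I I.tangent ∞ fun x => (⟨x, X x⟩ : TangentBundle I M)

/-- The vector field `x ↦ T_x (X x)`. -/
def EndomorphismField.app (T : EndomorphismField I M) (X : ∀ x : M, TangentSpace I x) :
    ∀ x : M, TangentSpace I x := fun x => T x (X x)

/-- The Nijenhuis condition
`[TX, TY] + ε [X, Y] - T [TX, Y] - T [X, TY] = 0` for all smooth vector fields `X`, `Y`. -/
def EndomorphismField.NijenhuisVanishes (T : EndomorphismField I M) (ε : ℝ) : Prop :=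
  ∀ X Y : ∀ x : M, TangentSpace I x, IsSmoothVectorField X → IsSmoothVectorField Y → ∀ x : M,
    mlieBracket I (T.app X) (T.app Y) x + ε • mlieBracket I X Y x
      - T x (mlieBracket I (T.app X) Y x) - T x (mlieBracket I X (T.app Y) x) = 0

/-- An (integrable) product structure: a field of involutions of the tangent spaces, of constant
trace, with vanishing Nijenhuis tensor. -/
structure IsProductStructure (P : EndomorphismField I M) : Prop where
  sq : ∀ (x : M) (v : TangentSpace I x), P x (P x v) = v
  trace_const : ∃ c : ℝ, ∀ x : M,
    LinearMap.trace ℝ (TangentSpace I x) (P x : TangentSpace I x →ₗ[ℝ] TangentSpace I x) = c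
  integrable : P.NijenhuisVanishes 1

/-- An (integrable) complex structure: a field of anti-involutions of the tangent spaces with
vanishing Nijenhuis tensor. -/
structure IsComplexStructure (J : EndomorphismField I M) : Prop where
  sq : ∀ (x : M) (v : TangentSpace I x), J x (J x v) = -v
  integrable : J.NijenhuisVanishes (-1)

/-- A complex product structure `(P, J)`. -/
structure IsComplexProductStructure (P J : EndomorphismField I M) : Prop where
  isProductStructure : IsProductStructure P
  isComplexStructure : IsComplexStructure J
  anticomm : ∀ (x : M) (v : TangentSpace I x), P x (J x v) = -J x (P x v)

/-- Compatibility of a metric with a pair `(P, J)`. -/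
structure PseudoRiemannianMetric.IsCompatible (g : PseudoRiemannianMetric I M)
    (P J : EndomorphismField I M) : Prop where
  complex : ∀ (x : M) (v w : TangentSpace I x), g x (J x v) (J x w) = g x v w
  product : ∀ (x : M) (v w : TangentSpace I x), g x (P x v) (P x w) = -g x v w

section LieGroup

variable {G : Type*} [TopologicalSpace G] [ChartedSpace H G] [Group G] [IsManifold I ∞ G]

/-- Invariance of an endomorphism field under all left translations. -/
def EndomorphismField.IsLeftInvariant (T : EndomorphismField I G) : Prop :=
  ∀ (a x : G) (v : TangentSpace I x),
    T (a * x) (mfderiv I I (fun y => a * y) x v) = mfderiv I I (fun y => a * y) x (T x v)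

/-- Invariance of a metric under all left and right translations. -/
structure PseudoRiemannianMetric.IsBiinvariant (g : PseudoRiemannianMetric I G) : Prop where
  left : ∀ (a x : G) (v w : TangentSpace I x),
    g (a * x) (mfderiv I I (fun y => a * y) x v) (mfderiv I I (fun y => a * y) x w) = g x v w
  right : ∀ (a x : G) (v w : TangentSpace I x),
    g (x * a) (mfderiv I I (fun y => y * a) x v) (mfderiv I I (fun y => y * a) x w) = g x v w

/-- `g` is the bi-invariant metric induced by the Killing form of the real Lie algebra `T_1 G`. -/
structure PseudoRiemannianMetric.IsKillingMetric [CompleteSpace E] [LieGroup I (minSmoothness ℝ 3) G]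
    (g : PseudoRiemannianMetric I G) : Prop where
  biinvariant : g.IsBiinvariant
  eq_killingForm : ∀ v w : GroupLieAlgebra I G,
    g 1 v w = killingForm ℝ (GroupLieAlgebra I G) v w

end LieGroup

end Geometry

end

/-! The problem is first reduced to linear algebra on the Lie algebra 𝔤 of G. Left-invariant fields
are smooth, and their pointwise identities hold everywhere once they hold at 1. If T² = ε, the
Nijenhuis expression of T is tensorial, so it can be tested on left-invariant vector fields, where
it becomes an identity for the bracket of 𝔤 (`EndomorphismField.nijenhuisVanishes_leftInvariant`).
For a matrix group this bracket is the commutator (`LinearLieGroup.coe_bracket`), and the Killing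
form is a nonzero multiple of Re tr(vw): the factor is 4n for sl(n, ℂ) over ℝ and 2n for su(p, q)
with n = p + q. Cyclicity of the trace gives right invariance.

For n = 2k+1, cut a trace-free matrix into 2 × 2 blocks A i j, a column of k vectors v, a row of k
covectors ξ, and a corner entry determined by the trace. A matrix B in M₂(ℂ) acts by A i j ↦ B A i j
for i ≤ j, A i j ↦ A i j adj(B) for i > j, v ↦ Bv, ξ ↦ ξ adj(B). Since adj(B)B = det B, the pairings
of A i j with A j i (i ≠ j) and of ξ with v are multiplied by det B. On a diagonal block the form
with this property is -tr(A adj A'), which agrees with tr(AA') on trace-free parts and has the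
opposite sign on scalar parts. With the corner included, the scalar parts carry the form 2 ∑ sᵢtᵢ +
4 (∑ sᵢ)(∑ tᵢ), which over ℂ is isometric to -2 ∑ cᵢdᵢ. Transporting the action through the isometry
`twist` gives an action of M₂(ℂ) on sl(2k+1, ℂ) that scales the trace form by det B
(`OddSl.trace_act_mul`). P and J are the actions of `swapOp` and `complexOp`: these anticommute,
have squares 1 and -1 and determinants -1 and 1.

Integrability comes from `diagOp`: in the order given by `rank`, its eigenspaces consist of
triangular matrices, and commutators of triangular matrices are strictly triangular
(`OddSl.nijenhuis_act_diagOp`). `swapOp` is conjugate to `diagOp`, and `complexOp` is i times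
`diagOp`. Finally, `swapOp` and `complexOp` both lie in su(1,1), so both actions preserve the real
form su(k+1, k) (`OddSl.IsSkew.act`); here it matters that `twist` exchanges imaginary and real
vectors. -/

noncomputable section

/-! ### Left-invariant endomorphism fields and metrics -/

section LeftInvariant

open Bundle VectorField ContinuousLinearMap

variable {E : Type*} [NormedAddCommGroup E] [NormedSpace ℝ E]
  {H : Type*} [TopologicalSpace H] {I : ModelWithCorners ℝ E H}
  {G : Type*} [TopologicalSpace G] [ChartedSpace H G] [Group G]

variable (I) in
/-- The derivative at `1` of the left translation by `x`. -/
def leftTrans (x : G) : GroupLieAlgebra I G →L[ℝ] TangentSpace I x :=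
  mfderiv I I (fun y => x * y) 1

variable (I) in
/-- The derivative at `x` of the left translation by `x⁻¹`. -/
def leftTransInv (x : G) : TangentSpace I x →L[ℝ] GroupLieAlgebra I G :=
  mfderiv I I (fun y => x⁻¹ * y) x

theorem mfderiv_one_mul (x : G) (v : E) :
    (mfderiv I I (fun z : G => 1 * z) x : E →L[ℝ] E) v = v := by
  have : (fun z : G => 1 * z) = id := funext one_mul
  rw [this, mfderiv_id]
  rfl

variable [LieGroup I ω G]

/-- Chain rule for translations. The products enter through equations and the derivatives act on the
model space `E`, so base points such as `x⁻¹ * x` and `1`, equal only propositionally, need no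
transport. -/
theorem mfderiv_mul_left_comp {a b c x y : G} (hc : a * b = c) (hy : b * x = y) (v : E) :
    (mfderiv I I (fun z => c * z) x : E →L[ℝ] E) v =
      (mfderiv I I (fun z => a * z) y : E →L[ℝ] E) ((mfderiv I I (fun z => b * z) x : E →L[ℝ] E) v) := by
  subst hc hy
  have h (d w : G) : MDifferentiableAt I I (fun z => d * z) w :=
    (contMDiff_mul_left (I := I) (n := ω)).contMDiffAt.mdifferentiableAt (by simp)
  have e := mfderiv_comp x (h a (b * x)) (h b x)
  have e2 : (fun z => a * z) ∘ (fun z => b * z) = fun z => a * b * z :=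
    funext fun z => (mul_assoc a b z).symm
  rw [e2] at e
  exact DFunLike.congr_fun e v

theorem leftTransInv_leftTrans (x : G) (v : GroupLieAlgebra I G) :
    leftTransInv I x (leftTrans I x v) = v := by
  exact (mfderiv_mul_left_comp (E := E) (I := I) (inv_mul_cancel x) (mul_one x) v).symm.trans (mfderiv_one_mul (E := E) (I := I) 1 v)

theorem leftTrans_leftTransInv (x : G) (v : TangentSpace I x) :
    leftTrans I x (leftTransInv I x v) = v := by
  exact (mfderiv_mul_left_comp (E := E) (I := I) (mul_inv_cancel x) (inv_mul_cancel x) v).symm.trans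
    (mfderiv_one_mul (E := E) (I := I) x v)

theorem mfderiv_mul_left_leftTrans (a x : G) (v : GroupLieAlgebra I G) :
    mfderiv I I (fun y => a * y) x (leftTrans I x v) = leftTrans I (a * x) v := by
  exact (mfderiv_mul_left_comp (E := E) (I := I) rfl (mul_one x) v).symm

theorem leftTransInv_mfderiv_mul_left (a x : G) (v : TangentSpace I x) :
    leftTransInv I (a * x) (mfderiv I I (fun y => a * y) x v) = leftTransInv I x v := by
  have h := leftTrans_leftTransInv (I := I) x v
  rw [← h, mfderiv_mul_left_leftTrans, leftTransInv_leftTrans, leftTransInv_leftTrans]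

/-- `leftTrans` is the partial derivative of the multiplication in its second variable along the
points (x, 1), and a partial derivative of an analytic map depends smoothly on the parameter. -/
theorem contMDiffAt_inTangentCoordinates_leftTrans (x₀ : G) :
    ContMDiffAt I 𝓘(ℝ, E →L[ℝ] E) ∞ (inTangentCoordinates I I (fun _ : G => (1 : G)) id
      (fun x => leftTrans I x) x₀) x₀ := by
  have h := ContMDiffAt.mfderiv (I := I) (I' := I) (J := I) (n := ω) (m := ∞) (x₀ := x₀)
    (fun x y : G => x * y) (fun _ => 1) (contMDiff_mul I ω).contMDiffAt contMDiffAt_const le_top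
  have e : (fun x : G => x * 1) = id := funext mul_one
  rw [e] at h
  exact h

theorem contMDiffAt_inTangentCoordinates_leftTransInv (x₀ : G) :
    ContMDiffAt I 𝓘(ℝ, E →L[ℝ] E) ∞ (inTangentCoordinates I I id (fun _ : G => (1 : G))
      (fun x => leftTransInv I x) x₀) x₀ := by
  have h := ContMDiffAt.mfderiv (I := I) (I' := I) (J := I) (n := ω) (m := ∞) (x₀ := x₀)
    (fun x y : G => x⁻¹ * y) id
    (((contMDiff_inv I ω).comp contMDiff_fst).mul contMDiff_snd).contMDiffAt contMDiffAt_id le_top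
  have e : (fun x : G => x⁻¹ * id x) = fun _ => 1 := funext inv_mul_cancel
  rw [e] at h
  exact h

/-- The left-invariant field of endomorphisms with value `T` at `1`. -/
def EndomorphismField.leftInvariant (T : GroupLieAlgebra I G →L[ℝ] GroupLieAlgebra I G) :
    EndomorphismField I G where
  toFun x := (leftTrans I x).comp (T.comp (leftTransInv I x))
  contMDiff x₀ := by
    rw [contMDiffAt_hom_bundle]
    refine ⟨contMDiffAt_id, ?_⟩
    have h1 := contMDiffAt_inTangentCoordinates_leftTrans (I := I) x₀
    have h2 := contMDiffAt_inTangentCoordinates_leftTransInv (I := I) x₀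
    -- The middle factor lives over the single point `1`, so it is constant in coordinates. The
    -- coordinate changes at `1` inserted around it cancel below.
    have h3 : ContMDiffAt I 𝓘(ℝ, E →L[ℝ] E) ∞ (fun _ : G => inCoordinates E (TangentSpace I) E
      (TangentSpace I) (1 : G) 1 (1 : G) 1 T) x₀ := contMDiffAt_const
    refine (h1.clm_comp (h3.clm_comp h2)).congr_of_eventuallyEq (Filter.Eventually.of_forall
      fun x => ?_)
    ext v
    simp only [inTangentCoordinates, inCoordinates, ContinuousLinearMap.comp_apply]
    have h0 := FiberBundle.mem_baseSet_trivializationAt' (F := E) (E := TangentSpace I) (1 : G)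
    erw [Trivialization.symmL_continuousLinearMapAt _ h0,
      Trivialization.symmL_continuousLinearMapAt _ h0]
    rfl

theorem EndomorphismField.leftInvariant_leftTrans
    (T : GroupLieAlgebra I G →L[ℝ] GroupLieAlgebra I G) (x : G) (v : GroupLieAlgebra I G) :
    EndomorphismField.leftInvariant T x (leftTrans I x v) = leftTrans I x (T v) :=
  congrArg (fun w => leftTrans I x (T w)) (leftTransInv_leftTrans x v)

theorem EndomorphismField.isLeftInvariant_leftInvariant
    (T : GroupLieAlgebra I G →L[ℝ] GroupLieAlgebra I G) :
    (EndomorphismField.leftInvariant T).IsLeftInvariant := by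
  intro a x v
  rw [← leftTrans_leftTransInv x v, mfderiv_mul_left_leftTrans, leftInvariant_leftTrans,
    leftInvariant_leftTrans, mfderiv_mul_left_leftTrans]

/-- The left-invariant pseudo-Riemannian metric with value `B` at `1`. -/
def PseudoRiemannianMetric.leftInvariant [FiniteDimensional ℝ E]
    (B : GroupLieAlgebra I G →L[ℝ] GroupLieAlgebra I G →L[ℝ] ℝ)
    (hs : ∀ v w, B v w = B w v) (hn : ∀ v, (∀ w, B v w = 0) → v = 0) :
    PseudoRiemannianMetric I G where
  toFun x := (ContinuousLinearMap.bilinearComp (E := E) (F := E) B (leftTransInv I x)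
    (leftTransInv I x) : E →L[ℝ] E →L[ℝ] ℝ)
  contMDiff x₀ := by
    rw [contMDiffAt_hom_bundle]
    refine ⟨contMDiffAt_id, ?_⟩
    have h2 := contMDiffAt_inTangentCoordinates_leftTransInv (I := I) x₀
    have h3 : ContMDiffAt I 𝓘(ℝ, E →L[ℝ] E →L[ℝ] ℝ) ∞ (fun _ : G => ContinuousLinearMap.bilinearComp
      (E := E) (F := E) (E' := E) (F' := E) B
      ((trivializationAt E (TangentSpace I) (1 : G)).symmL ℝ 1)
      ((trivializationAt E (TangentSpace I) (1 : G)).symmL ℝ 1)) x₀ := contMDiffAt_const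
    -- The form (v, w) ↦ K(Cv, Cw) is written as a composition of linear maps, (· ∘ C) ∘ K ∘ C, so
    -- that smoothness in C follows from smoothness of composition.
    have h4 : ContMDiffAt I 𝓘(ℝ, (E →L[ℝ] ℝ) →L[ℝ] (E →L[ℝ] ℝ)) ∞ (fun x : G =>
      (compL ℝ E E ℝ).flip (inTangentCoordinates I I id (fun _ : G => (1 : G))
      (fun x => leftTransInv I x) x₀ x)) x₀ :=
      ContMDiffAt.comp x₀ (g := (compL ℝ E E ℝ).flip)
        (ContinuousLinearMap.contMDiff (n := ∞) _).contMDiffAt h2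
    refine (h4.clm_comp (h3.clm_comp h2)).congr_of_eventuallyEq ?_
    filter_upwards [(trivializationAt E (TangentSpace I) x₀).open_baseSet.mem_nhds
      (FiberBundle.mem_baseSet_trivializationAt' (F := E) (E := TangentSpace I) x₀)] with x hx
    have h0 := FiberBundle.mem_baseSet_trivializationAt' (F := E) (E := TangentSpace I) (1 : G)
    ext v w
    erw [inCoordinates_apply_eq₂ hx hx (Set.mem_univ _)]
    have h5 (u : E) := Trivialization.symmL_continuousLinearMapAt (R := ℝ) _ h0 u
    have h6 (C : E →L[ℝ] E) (K : E →L[ℝ] E →L[ℝ] ℝ) (v w : E) :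
        ((compL ℝ E E ℝ).flip C).comp (K.comp C) v w = K (C v) (C w) := by simp
    refine (DFunLike.congr_fun (Bundle.Trivial.linearMapAt_trivialization ℝ G ℝ x) _).trans
      (Eq.trans ?_ (h6 _ _ _ _).symm)
    have h7 (u : E) : (trivializationAt E (TangentSpace I) x₀).symm x u =
      (trivializationAt E (TangentSpace I) x₀).symmL ℝ x u := (Trivialization.symmL_apply _ hx u).symm
    rw [h7, h7]
    exact (congrArg₂ (fun a b : E => (B : E →L[ℝ] E →L[ℝ] ℝ) a b)
      (h5 (leftTransInv I x ((trivializationAt E (TangentSpace I) x₀).symmL ℝ x v)))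
      (h5 (leftTransInv I x ((trivializationAt E (TangentSpace I) x₀).symmL ℝ x w)))).symm
  symm x v w := hs _ _
  nondegenerate x v h := by
    have h1 := hn (leftTransInv I x v) fun w => by
      have := h (leftTrans I x w)
      exact (congrArg (B (leftTransInv I x v)) (leftTransInv_leftTrans x w)).symm.trans this
    rw [← leftTrans_leftTransInv x v, h1, map_zero]

end LeftInvariant

/-! ### Tensoriality of the Nijenhuis expression and reduction to the Lie algebra -/

section Nijenhuis

open Bundle VectorField

variable {E : Type*} [NormedAddCommGroup E] [NormedSpace ℝ E]
  {H : Type*} [TopologicalSpace H] {I : ModelWithCorners ℝ E H}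

namespace EndomorphismField

variable {M : Type*} [TopologicalSpace M] [ChartedSpace H M] [IsManifold I ∞ M]
  (T : EndomorphismField I M) (ε : ℝ)

/-- The expression whose vanishing is the Nijenhuis condition. -/
def nijenhuis (X Y : ∀ x : M, TangentSpace I x) (x : M) : TangentSpace I x :=
  mlieBracket I (T.app X) (T.app Y) x + ε • mlieBracket I X Y x
    - T x (mlieBracket I (T.app X) Y x) - T x (mlieBracket I X (T.app Y) x)

theorem mdifferentiableAt_app {X : ∀ x : M, TangentSpace I x} {x : M}
    (hX : MDifferentiableAt I I.tangent (fun y => (⟨y, X y⟩ : TangentBundle I M)) x) :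
    MDifferentiableAt I I.tangent (fun y => (⟨y, T.app X y⟩ : TangentBundle I M)) x :=
  MDifferentiableAt.clm_bundle_apply (F₁ := E) (F₂ := E) (E₁ := TangentSpace I)
    (E₂ := TangentSpace I) (b := id) (ϕ := fun y => T y)
    (T.contMDiff.contMDiffAt.mdifferentiableAt (by simp)) hX

theorem app_smul (f : M → ℝ) (X : ∀ x : M, TangentSpace I x) : T.app (f • X) = f • T.app X :=
  funext fun x => (T x).map_smul (f x) (X x)

theorem app_add (X Y : ∀ x : M, TangentSpace I x) : T.app (X + Y) = T.app X + T.app Y :=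
  funext fun x => (T x).map_add (X x) (Y x)

theorem nijenhuis_swap (X Y : ∀ x : M, TangentSpace I x) (x : M) :
    T.nijenhuis ε X Y x = -T.nijenhuis ε Y X x := by
  unfold nijenhuis
  rw [mlieBracket_swap_apply (V := T.app X) (W := T.app Y), mlieBracket_swap_apply (V := X) (W := Y),
    mlieBracket_swap_apply (V := T.app X) (W := Y), mlieBracket_swap_apply (V := X) (W := T.app Y)]
  simp only [map_neg, smul_neg]
  abel

variable [FiniteDimensional ℝ E] {T ε}

/-- When X is multiplied by f, the four brackets produce derivative terms of f along Y and TY. Those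
along TY, with vector TX, cancel directly; those along Y have vectors εX and T(TX), which cancel
because T² = ε. -/
theorem tensorialAt_nijenhuis (hT : ∀ (x : M) (v : TangentSpace I x), T x (T x v) = ε • v)
    (Y : ∀ x : M, TangentSpace I x) (x : M) :
    TensorialAt I E (fun X => T.nijenhuis ε X Y x) x where
  smul {f X} hf hX := by
    have := FiniteDimensional.complete ℝ E
    simp only [nijenhuis, app_smul]
    rw [mlieBracket_smul_left hf hX, mlieBracket_smul_left hf hX,
      mlieBracket_smul_left hf (T.mdifferentiableAt_app hX),
      mlieBracket_smul_left hf (T.mdifferentiableAt_app hX)]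
    have h1 := hT x (X x)
    have h2 : T.app X x = T x (X x) := rfl
    simp only [map_add, map_smul, smul_add, h2, h1]
    module
  add {X X'} hX hX' := by
    have := FiniteDimensional.complete ℝ E
    simp only [nijenhuis, app_add]
    rw [mlieBracket_add_left hX hX', mlieBracket_add_left hX hX',
      mlieBracket_add_left (T.mdifferentiableAt_app hX) (T.mdifferentiableAt_app hX'),
      mlieBracket_add_left (T.mdifferentiableAt_app hX) (T.mdifferentiableAt_app hX')]
    simp only [map_add, smul_add]
    abel

theorem nijenhuis_eq_of_apply_eq (hT : ∀ (x : M) (v : TangentSpace I x), T x (T x v) = ε • v)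
    {X X' Y Y' : ∀ x : M, TangentSpace I x} {x : M}
    (hX : MDifferentiableAt I I.tangent (fun y => (⟨y, X y⟩ : TangentBundle I M)) x)
    (hX' : MDifferentiableAt I I.tangent (fun y => (⟨y, X' y⟩ : TangentBundle I M)) x)
    (hY : MDifferentiableAt I I.tangent (fun y => (⟨y, Y y⟩ : TangentBundle I M)) x)
    (hY' : MDifferentiableAt I I.tangent (fun y => (⟨y, Y' y⟩ : TangentBundle I M)) x)
    (h : X x = X' x) (h' : Y x = Y' x) :
    T.nijenhuis ε X Y x = T.nijenhuis ε X' Y' x := by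
  rw [(tensorialAt_nijenhuis hT Y x).pointwise hX hX' h, nijenhuis_swap T ε X' Y,
    nijenhuis_swap T ε X' Y', (tensorialAt_nijenhuis hT X' x).pointwise hY hY' h']

end EndomorphismField

variable {G : Type*} [TopologicalSpace G] [ChartedSpace H G] [Group G] [LieGroup I ω G]

theorem EndomorphismField.app_leftInvariant (T : GroupLieAlgebra I G →L[ℝ] GroupLieAlgebra I G)
    (v : GroupLieAlgebra I G) :
    (leftInvariant T).app (mulInvariantVectorField v) = mulInvariantVectorField (T v) :=
  funext fun x => leftInvariant_leftTrans T x v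

variable [FiniteDimensional ℝ E] [CompleteSpace E]

/-- By tensoriality, X and Y may be replaced by the left-invariant fields with the same values at x.
`leftInvariant T` sends left-invariant fields to left-invariant fields, so all four terms are left
translates of brackets in the Lie algebra. -/
theorem EndomorphismField.nijenhuisVanishes_leftInvariant {ε : ℝ}
    {T : GroupLieAlgebra I G →L[ℝ] GroupLieAlgebra I G}
    (hT : ∀ v, T (T v) = ε • v)
    (hN : ∀ v w, ⁅T v, T w⁆ + ε • ⁅v, w⁆ - T ⁅T v, w⁆ - T ⁅v, T w⁆ = 0) :
    (leftInvariant T).NijenhuisVanishes ε := by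
  intro X Y hX hY x
  have hT' (x : G) (v : TangentSpace I x) :
      leftInvariant T x (leftInvariant T x v) = ε • v := by
    rw [← leftTrans_leftTransInv x v, leftInvariant_leftTrans, leftInvariant_leftTrans, hT,
      map_smul]
  have key (v w : GroupLieAlgebra I G) : mlieBracket I (mulInvariantVectorField v)
      (mulInvariantVectorField w) x = leftTrans I x ⁅v, w⁆ := by
    rw [← mulInvariantVector_mlieBracket]
    rfl
  have h1 (X : ∀ x : G, TangentSpace I x) :
      X x = (mulInvariantVectorField (leftTransInv I x (X x)) : ∀ x : G, TangentSpace I x) x :=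
    (leftTrans_leftTransInv x (X x)).symm
  refine (nijenhuis_eq_of_apply_eq hT' (hX.mdifferentiable (by simp) x)
    (mdifferentiableAt_mulInvariantVectorField _) (hY.mdifferentiable (by simp) x)
    (mdifferentiableAt_mulInvariantVectorField _) (h1 X) (h1 Y)).trans ?_
  simp only [nijenhuis, app_leftInvariant, key, leftInvariant_leftTrans]
  rw [← map_smul, ← map_add, ← map_sub, ← map_sub, hN, map_zero]

/-- A Lie group whose Killing form is nondegenerate and right invariant, with an algebraic complex
product structure on its Lie algebra compatible with the Killing form, has a left-invariant complex
product structure compatible with the Killing metric. -/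
theorem exists_killingMetric_complexProduct
    (hκ : (killingForm ℝ (GroupLieAlgebra I G)).Nondegenerate)
    (hAd : ∀ (a x : G) (v w : TangentSpace I x),
      killingForm ℝ (GroupLieAlgebra I G)
        (leftTransInv I (x * a) (mfderiv I I (fun y => y * a) x v))
        (leftTransInv I (x * a) (mfderiv I I (fun y => y * a) x w)) =
      killingForm ℝ (GroupLieAlgebra I G) (leftTransInv I x v) (leftTransInv I x w))
    (P J : GroupLieAlgebra I G →ₗ[ℝ] GroupLieAlgebra I G)
    (hP : ∀ v, P (P v) = v) (hJ : ∀ v, J (J v) = -v) (hPJ : ∀ v, P (J v) = -J (P v))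
    (hNP : ∀ v w, ⁅P v, P w⁆ + ⁅v, w⁆ - P ⁅P v, w⁆ - P ⁅v, P w⁆ = 0)
    (hNJ : ∀ v w, ⁅J v, J w⁆ - ⁅v, w⁆ - J ⁅J v, w⁆ - J ⁅v, J w⁆ = 0)
    (hκP : ∀ v w, killingForm ℝ (GroupLieAlgebra I G) (P v) (P w) = -killingForm ℝ _ v w)
    (hκJ : ∀ v w, killingForm ℝ (GroupLieAlgebra I G) (J v) (J w) = killingForm ℝ _ v w) :
    ∃ g : PseudoRiemannianMetric I G, g.IsKillingMetric ∧
      ∃ P J : EndomorphismField I G,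
        IsComplexProductStructure P J ∧ P.IsLeftInvariant ∧ J.IsLeftInvariant ∧
          g.IsCompatible P J := by
  have : FiniteDimensional ℝ (GroupLieAlgebra I G) := ‹FiniteDimensional ℝ E›
  let cE : (E →ₗ[ℝ] E) → (E →L[ℝ] E) := fun S => LinearMap.toContinuousLinearMap S
  let cE₂ : (E →ₗ[ℝ] E →ₗ[ℝ] ℝ) → (E →L[ℝ] E →L[ℝ] ℝ) :=
    fun S => LinearMap.toContinuousBilinearMap S
  let toC : (GroupLieAlgebra I G →ₗ[ℝ] GroupLieAlgebra I G) →
    (GroupLieAlgebra I G →L[ℝ] GroupLieAlgebra I G) := cE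
  let B : GroupLieAlgebra I G →L[ℝ] GroupLieAlgebra I G →L[ℝ] ℝ :=
    cE₂ (killingForm ℝ (GroupLieAlgebra I G))
  have hB (v w : GroupLieAlgebra I G) : B v w = killingForm ℝ (GroupLieAlgebra I G) v w := rfl
  let g : PseudoRiemannianMetric I G := .leftInvariant B
    (fun v w => LieModule.traceForm_comm ℝ _ _ v w) (fun v h => hκ.1 v h)
  have hg (x : G) (v w : TangentSpace I x) : g x v w =
    killingForm ℝ (GroupLieAlgebra I G) (leftTransInv I x v) (leftTransInv I x w) := rfl
  let P' := EndomorphismField.leftInvariant (I := I) (toC P)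
  let J' := EndomorphismField.leftInvariant (I := I) (toC J)
  have hP' (x : G) (v : GroupLieAlgebra I G) : P' x (leftTrans I x v) = leftTrans I x (P v) :=
    EndomorphismField.leftInvariant_leftTrans _ x v
  have hJ' (x : G) (v : GroupLieAlgebra I G) : J' x (leftTrans I x v) = leftTrans I x (J v) :=
    EndomorphismField.leftInvariant_leftTrans _ x v
  have hs {p : ∀ x : G, TangentSpace I x → Prop} (x : G) (h : ∀ v, p x (leftTrans I x v))
      (v : TangentSpace I x) : p x v := leftTrans_leftTransInv x v ▸ h _
  refine ⟨g, ⟨⟨fun a x v w => ?_, fun a x v w => ?_⟩, fun v w => ?_⟩, P', J', ⟨⟨?_, ?_, ?_⟩,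
    ⟨?_, ?_⟩, ?_⟩, EndomorphismField.isLeftInvariant_leftInvariant _,
    EndomorphismField.isLeftInvariant_leftInvariant _, ⟨?_, ?_⟩⟩
  · rw [hg, hg, leftTransInv_mfderiv_mul_left, leftTransInv_mfderiv_mul_left]
  · exact hAd a x v w
  · have h1 (v : GroupLieAlgebra I G) : leftTransInv I (1 : G) v = v := by
      refine Eq.trans ?_ (leftTransInv_leftTrans (I := I) (1 : G) v)
      exact congrArg (leftTransInv I (1 : G)) (mfderiv_one_mul (E := E) (I := I) 1 v).symm
    rw [hg, h1, h1]
  · intro x v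
    rw [← leftTrans_leftTransInv x v, hP', hP', hP]
  · refine ⟨LinearMap.trace ℝ _ P, fun x => ?_⟩
    -- Left translation conjugates the value of the field at `x` to `P`, so all values have the same
    -- trace.
    let e : GroupLieAlgebra I G ≃ₗ[ℝ] TangentSpace I x :=
      LinearEquiv.ofLinearMap (leftTrans I x) (leftTransInv I x)
        (LinearMap.ext (leftTrans_leftTransInv x)) (LinearMap.ext (leftTransInv_leftTrans x))
    exact LinearMap.trace_conj' P e
  · exact EndomorphismField.nijenhuisVanishes_leftInvariant (fun v => by
      rw [one_smul]; exact hP v) (fun v w => by rw [one_smul]; exact hNP v w)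
  · intro x v
    rw [← leftTrans_leftTransInv x v, hJ', hJ', hJ, map_neg]
  · exact EndomorphismField.nijenhuisVanishes_leftInvariant (fun v => by
      rw [neg_one_smul]; exact hJ v) (fun v w => by
      rw [neg_one_smul, ← sub_eq_add_neg]; exact hNJ v w)
  · intro x v
    rw [← leftTrans_leftTransInv x v, hJ', hP', hP', hJ', hPJ, map_neg]
  · intro x v w
    rw [← leftTrans_leftTransInv x v, ← leftTrans_leftTransInv x w, hJ', hJ', hg, hg,
      leftTransInv_leftTrans, leftTransInv_leftTrans, hκJ, leftTransInv_leftTrans,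
      leftTransInv_leftTrans]
  · intro x v w
    rw [← leftTrans_leftTransInv x v, ← leftTrans_leftTransInv x w, hP', hP', hg, hg,
      leftTransInv_leftTrans, leftTransInv_leftTrans, hκP, leftTransInv_leftTrans,
      leftTransInv_leftTrans]

end Nijenhuis

/-! ### Lie brackets of related vector fields -/

section RelatedFields

open VectorField

variable {E : Type*} [NormedAddCommGroup E] [NormedSpace ℝ E]
  {F : Type*} [NormedAddCommGroup F] [NormedSpace ℝ F]

/-- Differentiating the relation f'(y)(V y) = V'(f y) brings in the second derivative of f, which is
symmetric and therefore cancels in the bracket. -/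
theorem fderiv_lieBracket_of_related {f : E → F} {V W : E → E} {V' W' : F → F} {x : E}
    (hf : ContDiffAt ℝ 2 f x) (hV : DifferentiableAt ℝ V x) (hW : DifferentiableAt ℝ W x)
    (hV' : DifferentiableAt ℝ V' (f x)) (hW' : DifferentiableAt ℝ W' (f x))
    (hVV' : ∀ᶠ y in 𝓝 x, fderiv ℝ f y (V y) = V' (f y))
    (hWW' : ∀ᶠ y in 𝓝 x, fderiv ℝ f y (W y) = W' (f y)) :
    fderiv ℝ f x (lieBracket ℝ V W x) = lieBracket ℝ V' W' (f x) := by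
  have hd : DifferentiableAt ℝ (fderiv ℝ f) x :=
    (hf.fderiv_right (m := 1) (by norm_num)).differentiableAt (by simp)
  have hs : IsSymmSndFDerivAt ℝ f x := hf.isSymmSndFDerivAt (by simp)
  have key {V : E → E} {V' : F → F} (hV : DifferentiableAt ℝ V x)
      (hV' : DifferentiableAt ℝ V' (f x)) (h : ∀ᶠ y in 𝓝 x, fderiv ℝ f y (V y) = V' (f y)) (w : E) :
      fderiv ℝ f x (fderiv ℝ V x w) =
        fderiv ℝ V' (f x) (fderiv ℝ f x w) - fderiv ℝ (fderiv ℝ f) x w (V x) := by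
    have h1 := Filter.EventuallyEq.fderiv_eq (𝕜 := ℝ) h
    have h2 := (hd.hasFDerivAt.clm_apply hV.hasFDerivAt).fderiv
    have h3 := fderiv_fun_comp x hV' (hf.differentiableAt (by simp))
    have h4 := DFunLike.congr_fun (h2.symm.trans (h1.trans h3)) w
    simp only [add_apply, ContinuousLinearMap.comp_apply,
      ContinuousLinearMap.flip_apply] at h4
    rw [← h4]
    abel
  rw [lieBracket, map_sub, key hV hV' hVV', key hW hW' hWW', hVV'.self_of_nhds, hWW'.self_of_nhds,
    hs.eq, lieBracket]
  abel

variable {M : Type*} [TopologicalSpace M] [ChartedSpace E M] [IsManifold 𝓘(ℝ, E) ∞ M]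
  [CompleteSpace E]

/-- The manifold bracket is by definition the bracket of the fields pulled back to the chart at `x`;
those are related to V' and W' by f read in this chart, so the flat case applies. -/
theorem mfderiv_mlieBracket_of_related {f : M → F} {V W : ∀ x : M, TangentSpace 𝓘(ℝ, E) x}
    {V' W' : F → F} (hf : ContMDiff 𝓘(ℝ, E) 𝓘(ℝ, F) ∞ f) {x : M}
    (hV : MDifferentiableAt 𝓘(ℝ, E) 𝓘(ℝ, E).tangent
      (fun y => (⟨y, V y⟩ : TangentBundle 𝓘(ℝ, E) M)) x)
    (hW : MDifferentiableAt 𝓘(ℝ, E) 𝓘(ℝ, E).tangent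
      (fun y => (⟨y, W y⟩ : TangentBundle 𝓘(ℝ, E) M)) x)
    (hV' : DifferentiableAt ℝ V' (f x)) (hW' : DifferentiableAt ℝ W' (f x))
    (hVV' : ∀ y, mfderiv 𝓘(ℝ, E) 𝓘(ℝ, F) f y (V y) = V' (f y))
    (hWW' : ∀ y, mfderiv 𝓘(ℝ, E) 𝓘(ℝ, F) f y (W y) = W' (f y)) :
    mfderiv 𝓘(ℝ, E) 𝓘(ℝ, F) f x (mlieBracket 𝓘(ℝ, E) V W x) = lieBracket ℝ V' W' (f x) := by
  set φ := extChartAt 𝓘(ℝ, E) x with hφ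
  have hfd (y : M) : MDifferentiableAt 𝓘(ℝ, E) 𝓘(ℝ, F) f y := hf.mdifferentiable (by simp) y
  have hxt : φ x ∈ φ.target := mem_extChartAt_target x
  have htarget : φ.target ∈ 𝓝 (φ x) := extChartAt_target_mem_nhds x
  have hf' : ContDiffAt ℝ ∞ (f ∘ φ.symm) (φ x) := by
    rw [← contMDiffAt_iff_contDiffAt]
    have h1 := contMDiffWithinAt_extChartAt_symm_range (I := 𝓘(ℝ, E)) (n := ∞) x hxt
    rw [modelWithCornersSelf_coe, Set.range_id, contMDiffWithinAt_univ] at h1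
    exact (hf _).comp _ h1
  have hsymm {y : E} (hy : y ∈ φ.target) (U : ∀ x : M, TangentSpace 𝓘(ℝ, E) x) :
      fderiv ℝ (f ∘ φ.symm) y (mpullbackWithin 𝓘(ℝ, E) 𝓘(ℝ, E) φ.symm U
        (Set.range 𝓘(ℝ, E)) y) = mfderiv 𝓘(ℝ, E) 𝓘(ℝ, F) f (φ.symm y) (U (φ.symm y)) := by
    have h1 : MDifferentiableAt 𝓘(ℝ, E) 𝓘(ℝ, E) φ.symm y := by
      have := mdifferentiableWithinAt_extChartAt_symm (I := 𝓘(ℝ, E)) hy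
      rwa [modelWithCornersSelf_coe, Set.range_id, mdifferentiableWithinAt_univ] at this
    have h2 := isInvertible_mfderivWithin_extChartAt_symm (I := 𝓘(ℝ, E)) (x := x) hy
    rw [← mfderiv_eq_fderiv, mfderiv_comp y (hfd _) h1, mpullbackWithin_apply]
    rw [modelWithCornersSelf_coe, Set.range_id, mfderivWithin_univ] at h2 ⊢
    exact congrArg (mfderiv 𝓘(ℝ, E) 𝓘(ℝ, F) f (φ.symm y)) (h2.self_apply_inverse _)
  have hdiff {U : ∀ x : M, TangentSpace 𝓘(ℝ, E) x}
      (hU : MDifferentiableAt 𝓘(ℝ, E) 𝓘(ℝ, E).tangent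
        (fun y => (⟨y, U y⟩ : TangentBundle 𝓘(ℝ, E) M)) x) :
      DifferentiableAt ℝ (mpullbackWithin 𝓘(ℝ, E) 𝓘(ℝ, E) φ.symm U
        (Set.range 𝓘(ℝ, E))) (φ x) := by
    have h1 := (mdifferentiableWithinAt_univ.2 hU).differentiableWithinAt_mpullbackWithin_vectorField
    rw [Set.preimage_univ, Set.univ_inter, modelWithCornersSelf_coe, Set.range_id] at h1
    rw [modelWithCornersSelf_coe, Set.range_id]
    exact differentiableWithinAt_univ.1 h1
  have hleft : φ.symm (φ x) = x := extChartAt_to_inv x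
  have key := fderiv_lieBracket_of_related (hf'.of_le (by norm_cast)) (hdiff hV)
    (hdiff hW) (V' := V') (W' := W') (by simpa [hleft] using hV') (by simpa [hleft] using hW')
    (by filter_upwards [htarget] with y hy using (hsymm hy V).trans (hVV' _))
    (by filter_upwards [htarget] with y hy using (hsymm hy W).trans (hWW' _))
  rw [Function.comp_apply, hleft] at key
  have hφd : MDifferentiableAt 𝓘(ℝ, E) 𝓘(ℝ, E) φ x := mdifferentiableAt_extChartAt
    (ChartedSpace.mem_chart_source x)
  have hcomp : mfderiv 𝓘(ℝ, E) 𝓘(ℝ, F) f x = (mfderiv 𝓘(ℝ, E) 𝓘(ℝ, F) (f ∘ φ.symm) (φ x)).comp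
      (mfderiv 𝓘(ℝ, E) 𝓘(ℝ, E) φ x) := by
    rw [← mfderiv_comp x (hf'.differentiableAt (by simp)).mdifferentiableAt hφd]
    refine Filter.EventuallyEq.mfderiv_eq ?_
    filter_upwards [extChartAt_source_mem_nhds (I := 𝓘(ℝ, E)) x] with y hy
    exact congrArg f (φ.left_inv hy).symm
  have hinv : (mfderiv 𝓘(ℝ, E) 𝓘(ℝ, E) φ x).IsInvertible :=
    isInvertible_mfderiv_extChartAt (mem_extChartAt_source x)
  rw [← key, ← mlieBracketWithin_univ, mlieBracketWithin_apply, hcomp, mfderiv_eq_fderiv]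
  rw [Set.preimage_univ, Set.univ_inter, modelWithCornersSelf_coe, Set.range_id]
  refine (congrArg (fderiv ℝ (f ∘ φ.symm) (φ x)) (hinv.self_apply_inverse _)).trans ?_
  exact congrArg (fderiv ℝ (f ∘ φ.symm) (φ x)) (congrFun lieBracketWithin_univ _)

end RelatedFields

/-! ### The Lie algebra of a linear Lie group inside the ambient algebra -/

namespace LinearLieGroup

open VectorField

variable {A : Type*} [NormedRing A] [NormedAlgebra ℝ A] [FiniteDimensional ℝ A]
  {G : Type*} [Group G] [TopologicalSpace G] [IsTopologicalGroup G] (D : LinearLieGroup A G)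

theorem chart_self (g : G) : D.chart g g = 0 := by
  change D.proj (D.localExp.symm (D.incl (g⁻¹ * g))) = 0
  have h := D.localExp.left_inv D.zero_mem_source
  rw [D.localExp_apply, NormedSpace.exp_zero] at h
  rw [inv_mul_cancel, map_one, h, map_zero]

/-- The derivative of the representation at `x`. -/
def inclDeriv (x : G) : D.lie →L[ℝ] A :=
  letI := D.chartedSpace
  mfderiv 𝓘(ℝ, D.lie) 𝓘(ℝ, A) D.incl x

/-- In the logarithmic chart at `1` the representation is the exponential map, whose derivative at 0
is the identity. -/
theorem mfderiv_incl_one (v : D.lie) : D.inclDeriv (1 : G) v = v := by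
  let _ := D.chartedSpace
  have := FiniteDimensional.complete ℝ A
  have h0 : (0 : D.lie) ∈ (D.chart (1 : G)).target := by
    rw [← D.chart_self (1 : G)]
    exact (D.chart (1 : G)).map_source (D.mem_chart_source 1)
  have h1 : HasFDerivAt (fun X : D.lie => D.incl ((D.chart 1).symm X)) D.lie.subtypeL 0 := by
    have h2 : HasFDerivAt (fun X : D.lie => NormedSpace.exp (X : A)) D.lie.subtypeL 0 :=
      HasFDerivAt.comp (g := (NormedSpace.exp : A → A)) (g' := ContinuousLinearMap.id ℝ A)
        (0 : D.lie) (hasFDerivAt_exp_zero (𝕂 := ℝ)) D.lie.subtypeL.hasFDerivAt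
    refine h2.congr_of_eventuallyEq ?_
    filter_upwards [(D.chart (1 : G)).open_target.mem_nhds h0] with X hX
    rw [D.incl_chart_symm 1 hX, map_one, one_mul]
  have h2 : HasMFDerivAt 𝓘(ℝ, D.lie) 𝓘(ℝ, A) D.incl 1 D.lie.subtypeL := by
    refine ⟨D.isEmbedding.continuous.continuousAt, ?_⟩
    have h3 : extChartAt 𝓘(ℝ, D.lie) (1 : G) 1 = 0 := D.chart_self 1
    rw [h3]
    exact h1.hasFDerivWithinAt
  exact DFunLike.congr_fun h2.mfderiv v

theorem mdifferentiableAt_incl (x : G) : letI := D.chartedSpace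
    MDifferentiableAt 𝓘(ℝ, D.lie) 𝓘(ℝ, A) D.incl x := by
  let _ := D.chartedSpace
  exact D.contMDiff_incl.mdifferentiable (by simp) x

theorem mfderiv_incl_mul_left (a x : G) (v : D.lie) : letI := D.chartedSpace
    D.inclDeriv (a * x)
      (mfderiv 𝓘(ℝ, D.lie) 𝓘(ℝ, D.lie) (fun y => a * y) x v) =
    D.incl a * D.inclDeriv x v := by
  let _ := D.chartedSpace
  have := D.lieGroup
  have h1 := mfderiv_comp x (D.mdifferentiableAt_incl (a * x))
    ((contMDiff_mul_left (I := 𝓘(ℝ, D.lie)) (n := ω) (a := a)).mdifferentiable (by simp) x)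
  have h2 : D.incl ∘ (fun y => a * y) = (fun b => D.incl a * b) ∘ D.incl :=
    funext fun y => map_mul D.incl a y
  have h3 : HasFDerivAt (fun b => D.incl a * b) (ContinuousLinearMap.mul ℝ A (D.incl a))
    (D.incl x) := (ContinuousLinearMap.mul ℝ A (D.incl a)).hasFDerivAt
  rw [h2, mfderiv_comp x h3.differentiableAt.mdifferentiableAt (D.mdifferentiableAt_incl x),
    mfderiv_eq_fderiv, h3.fderiv] at h1
  exact (DFunLike.congr_fun h1 v).symm

theorem mfderiv_incl_mul_right (a x : G) (v : D.lie) : letI := D.chartedSpace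
    D.inclDeriv (x * a)
      (mfderiv 𝓘(ℝ, D.lie) 𝓘(ℝ, D.lie) (fun y => y * a) x v) =
    D.inclDeriv x v * D.incl a := by
  let _ := D.chartedSpace
  have := D.lieGroup
  have h1 := mfderiv_comp x (D.mdifferentiableAt_incl (x * a))
    ((contMDiff_mul_right (I := 𝓘(ℝ, D.lie)) (n := ω) (a := a)).mdifferentiable (by simp) x)
  have h2 : D.incl ∘ (fun y => y * a) = (fun b => b * D.incl a) ∘ D.incl :=
    funext fun y => map_mul D.incl y a
  have h3 : HasFDerivAt (fun b => b * D.incl a) ((ContinuousLinearMap.mul ℝ A).flip (D.incl a))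
    (D.incl x) := ((ContinuousLinearMap.mul ℝ A).flip (D.incl a)).hasFDerivAt
  rw [h2, mfderiv_comp x h3.differentiableAt.mdifferentiableAt (D.mdifferentiableAt_incl x),
    mfderiv_eq_fderiv, h3.fderiv] at h1
  exact (DFunLike.congr_fun h1 v).symm

theorem mfderiv_incl_leftTrans (x : G) (v : D.lie) : letI := D.chartedSpace
    D.inclDeriv x (leftTrans 𝓘(ℝ, D.lie) x v) =
      D.incl x * v := by
  let _ := D.chartedSpace
  have h := D.mfderiv_incl_mul_left x 1 v
  rw [D.mfderiv_incl_one] at h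
  rw [← h, mul_one]
  rfl

theorem coe_leftTransInv (x : G) (v : D.lie) : letI := D.chartedSpace
    D.lie.subtype (leftTransInv 𝓘(ℝ, D.lie) x v) =
      D.incl x⁻¹ * D.inclDeriv x v := by
  let _ := D.chartedSpace
  have := D.lieGroup
  have h := D.mfderiv_incl_leftTrans x (leftTransInv 𝓘(ℝ, D.lie) x v)
  have h2 := congrArg (D.inclDeriv x) (leftTrans_leftTransInv (I := 𝓘(ℝ, D.lie)) x v)
  rw [← h2, h, ← mul_assoc, ← map_mul, inv_mul_cancel, map_one, one_mul]
  rfl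

/-- The left-invariant field of v is related by the representation to the linear field a ↦ a v on
the ambient algebra. The flat bracket of a ↦ a v and a ↦ a w at 1 is vw - wv. -/
theorem coe_bracket : letI := D.chartedSpace
    ∀ v w : GroupLieAlgebra 𝓘(ℝ, D.lie) G,
      D.lie.subtype (⁅v, w⁆ : GroupLieAlgebra 𝓘(ℝ, D.lie) G) = D.lie.subtype v * D.lie.subtype w - D.lie.subtype w * D.lie.subtype v := by
  let _ := D.chartedSpace
  intro v w
  have := D.lieGroup
  have := FiniteDimensional.complete ℝ A
  have := FiniteDimensional.complete ℝ D.lie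
  have hd (u b : A) : HasFDerivAt (fun a : A => a * u) ((ContinuousLinearMap.mul ℝ A).flip u) b :=
    ((ContinuousLinearMap.mul ℝ A).flip u).hasFDerivAt
  have h := mfderiv_mlieBracket_of_related (E := D.lie) (M := G)
    (V := mulInvariantVectorField (I := 𝓘(ℝ, D.lie)) (G := G) v)
    (W := mulInvariantVectorField (I := 𝓘(ℝ, D.lie)) (G := G) w)
    (V' := fun a : A => a * D.lie.subtype v) (W' := fun a : A => a * D.lie.subtype w) (f := D.incl) (x := 1)
    (D.contMDiff_incl.of_le le_top) (mdifferentiableAt_mulInvariantVectorField _)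
    (mdifferentiableAt_mulInvariantVectorField _) (hd _ _).differentiableAt
    (hd _ _).differentiableAt (fun y => D.mfderiv_incl_leftTrans y v)
    (fun y => D.mfderiv_incl_leftTrans y w)
  refine (D.mfderiv_incl_one _).symm.trans (h.trans ?_)
  rw [lieBracket, (hd _ _).fderiv, (hd _ _).fderiv, map_one, one_mul, one_mul]
  rfl

/-- Let `D` be a linear Lie group whose Killing form is the restriction of the form `τ (v * w)` for
a tracial functional `τ`. A pair of endomorphisms of the ambient algebra which restricts to a complex
product structure on the Lie algebra compatible with this form induces a left-invariant complex
product structure on `G`, compatible with the Killing metric. -/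
theorem exists_killingMetric_complexProduct (τ : A →ₗ[ℝ] ℝ) (hτ : ∀ a b, τ (a * b) = τ (b * a))
    (hκ : ∀ v ∈ D.lie, ∀ w ∈ D.lie, ∀ f : D.lie →ₗ[ℝ] D.lie,
      (∀ z : D.lie, (f z : A) = v * (w * z - z * w) - (w * z - z * w) * v) →
        LinearMap.trace ℝ D.lie f = τ (v * w))
    (hnd : ∀ v ∈ D.lie, (∀ w ∈ D.lie, τ (v * w) = 0) → v = 0)
    (P J : A →ₗ[ℝ] A) (hPD : ∀ v ∈ D.lie, P v ∈ D.lie) (hJD : ∀ v ∈ D.lie, J v ∈ D.lie)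
    (hP : ∀ v ∈ D.lie, P (P v) = v) (hJ : ∀ v ∈ D.lie, J (J v) = -v)
    (hPJ : ∀ v ∈ D.lie, P (J v) = -J (P v))
    (hNP : ∀ v ∈ D.lie, ∀ w ∈ D.lie, (P v * P w - P w * P v) + (v * w - w * v)
      - P (P v * w - w * P v) - P (v * P w - P w * v) = 0)
    (hNJ : ∀ v ∈ D.lie, ∀ w ∈ D.lie, (J v * J w - J w * J v) - (v * w - w * v)
      - J (J v * w - w * J v) - J (v * J w - J w * v) = 0)
    (hκP : ∀ v ∈ D.lie, ∀ w ∈ D.lie, τ (P v * P w) = -τ (v * w))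
    (hκJ : ∀ v ∈ D.lie, ∀ w ∈ D.lie, τ (J v * J w) = τ (v * w)) :
    letI := D.chartedSpace
    haveI := D.lieGroup
    haveI := FiniteDimensional.complete ℝ D.lie
    ∃ g : PseudoRiemannianMetric 𝓘(ℝ, D.lie) G, g.IsKillingMetric ∧
      ∃ P J : EndomorphismField 𝓘(ℝ, D.lie) G,
        IsComplexProductStructure P J ∧ P.IsLeftInvariant ∧ J.IsLeftInvariant ∧
          g.IsCompatible P J := by
  let _ := D.chartedSpace
  have := D.lieGroup
  have := FiniteDimensional.complete ℝ D.lie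
  let L := GroupLieAlgebra 𝓘(ℝ, D.lie) G
  let ι : L →ₗ[ℝ] A := D.lie.subtype
  have hι : Function.Injective ι := Subtype.val_injective
  have hm (v : L) : ι v ∈ D.lie := Subtype.property (p := (· ∈ D.lie)) v
  have hb (v w : L) : ι ⁅v, w⁆ = ι v * ι w - ι w * ι v := D.coe_bracket v w
  have hk (v w : L) : killingForm ℝ L v w = τ (ι v * ι w) := by
    rw [LieModule.traceForm_apply_apply]
    refine hκ _ (hm v) _ (hm w) _ fun z => ?_
    have hz (z : L) : ι ⁅v, ⁅w, z⁆⁆ =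
        ι v * (ι w * ι z - ι z * ι w) - (ι w * ι z - ι z * ι w) * ι v := by rw [hb, hb]
    exact hz z
  let P' : L →ₗ[ℝ] L := P.restrict hPD
  let J' : L →ₗ[ℝ] L := J.restrict hJD
  have eP (v : L) : ι (P' v) = P (ι v) := rfl
  have eJ (v : L) : ι (J' v) = J (ι v) := rfl
  refine _root_.exists_killingMetric_complexProduct ?_ ?_ P' J' ?_ ?_ ?_ ?_ ?_ ?_ ?_
  · have h1 (v : L) (h : ∀ w, killingForm ℝ L v w = 0) : v = 0 := hι (by
      rw [map_zero]
      refine hnd _ (hm v) fun w hw => ?_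
      exact (hk v ⟨w, hw⟩).symm.trans (h _))
    refine ⟨h1, fun v h => h1 v fun w => ?_⟩
    rw [LieModule.traceForm_comm]
    exact h w
  · intro a x v w
    -- After translation to the identity from the left, right translation by `a` is conjugation by
    -- `a⁻¹`, which a tracial form does not see.
    have h1 (u : TangentSpace 𝓘(ℝ, D.lie) x) : ι (leftTransInv 𝓘(ℝ, D.lie) (x * a)
        (mfderiv 𝓘(ℝ, D.lie) 𝓘(ℝ, D.lie) (fun y => y * a) x u)) =
        D.incl a⁻¹ * ι (leftTransInv 𝓘(ℝ, D.lie) x u) * D.incl a := by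
      refine (D.coe_leftTransInv (x * a) _).trans ?_
      rw [D.mfderiv_incl_mul_right a x u]
      refine Eq.trans ?_ (congrArg (fun b => D.incl a⁻¹ * b * D.incl a)
        (D.coe_leftTransInv x u).symm)
      simp only [mul_inv_rev, map_mul, mul_assoc]
    have h2 (b : A) : D.incl a * (D.incl a⁻¹ * b) = b := by
      rw [← mul_assoc, ← map_mul, mul_inv_cancel, map_one, one_mul]
    rw [hk, hk, h1, h1, hτ]
    simp only [mul_assoc, h2]
    rw [hτ, mul_assoc, mul_assoc, ← map_mul, mul_inv_cancel, map_one, mul_one, hτ]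
  · exact fun v => hι (hP _ (hm v))
  · exact fun v => hι ((hJ _ (hm v)).trans (ι.map_neg v).symm)
  · exact fun v => hι ((hPJ _ (hm v)).trans (ι.map_neg (J' (P' v))).symm)
  · intro v w
    apply hι
    simp only [map_add, map_sub, map_zero, hb, eP]
    exact (by simpa only [map_sub] using hNP _ (hm v) _ (hm w))
  · intro v w
    apply hι
    simp only [map_sub, map_zero, hb, eJ]
    exact (by simpa only [map_sub] using hNJ _ (hm v) _ (hm w))
  · intro v w
    rw [hk, hk]
    exact hκP _ (hm v) _ (hm w)
  · intro v w
    rw [hk, hk]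
    exact hκJ _ (hm v) _ (hm w)

end LinearLieGroup

/-! ### A complex product structure on `sl(2k+1, ℂ)` -/

/-- Two linear endomorphisms of the space of matrices which restrict to a complex product structure
on the Lie algebra of trace-free matrices, compatible with the trace form. -/
structure IsTracelessComplexProduct {n : Type*} [Fintype n]
    (P J : Matrix n n ℂ →ₗ[ℂ] Matrix n n ℂ) : Prop where
  trace_product : ∀ x, (P x).trace = 0
  trace_complex : ∀ x, (J x).trace = 0
  product_sq : ∀ x, x.trace = 0 → P (P x) = x
  complex_sq : ∀ x, x.trace = 0 → J (J x) = -x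
  anticomm : ∀ x, x.trace = 0 → P (J x) = -J (P x)
  nijenhuis_product : ∀ x y, x.trace = 0 → y.trace = 0 →
    (P x * P y - P y * P x) + (x * y - y * x) - P (P x * y - y * P x) - P (x * P y - P y * x) = 0
  nijenhuis_complex : ∀ x y, x.trace = 0 → y.trace = 0 →
    (J x * J y - J y * J x) - (x * y - y * x) - J (J x * y - y * J x) - J (x * J y - J y * x) = 0
  trace_product_mul : ∀ x y, x.trace = 0 → y.trace = 0 → (P x * P y).trace = -(x * y).trace
  trace_complex_mul : ∀ x y, x.trace = 0 → y.trace = 0 → (J x * J y).trace = (x * y).trace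

/-- If both eigenspaces of an involution are closed under commutators, its Nijenhuis tensor
vanishes. -/
theorem nijenhuis_eq_zero_of_eigenspaces {R : Type*} [Ring R] [Algebra ℂ R] (W : Submodule ℂ R)
    (T : R →ₗ[ℂ] R) (hW : ∀ x, T x ∈ W) (hT : ∀ x ∈ W, T (T x) = x)
    (hp : ∀ x ∈ W, ∀ y ∈ W, T x = x → T y = y → T (x * y - y * x) = x * y - y * x)
    (hm : ∀ x ∈ W, ∀ y ∈ W, T x = -x → T y = -y → T (x * y - y * x) = -(x * y - y * x))
    {x y : R} (hx : x ∈ W) (hy : y ∈ W) :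
    (T x * T y - T y * T x) + (x * y - y * x) - T (T x * y - y * T x) - T (x * T y - T y * x)
      = 0 := by
  -- x + Tx and x - Tx lie in the two eigenspaces. The difference of the two closure relations is
  -- twice the desired identity.
  have h1 := hp _ (W.add_mem hx (hW x)) _ (W.add_mem hy (hW y))
    (by rw [map_add, hT x hx, add_comm]) (by rw [map_add, hT y hy, add_comm])
  have h2 := hm _ (W.sub_mem hx (hW x)) _ (W.sub_mem hy (hW y))
    (by rw [map_sub, hT x hx, neg_sub]) (by rw [map_sub, hT y hy, neg_sub])
  have h3 : (2 : ℂ) • ((T x * T y - T y * T x) + (x * y - y * x) - T (T x * y - y * T x)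
      - T (x * T y - T y * x)) = 0 := by
    have e1 : (x + T x) * (y + T y) - (y + T y) * (x + T x) =
      ((x * y - y * x) + (T x * T y - T y * T x)) +
        ((T x * y - y * T x) + (x * T y - T y * x)) := by noncomm_ring
    have e2 : (x - T x) * (y - T y) - (y - T y) * (x - T x) =
      ((x * y - y * x) + (T x * T y - T y * T x)) -
        ((T x * y - y * T x) + (x * T y - T y * x)) := by noncomm_ring
    rw [e1] at h1
    rw [e2] at h2
    generalize x * y - y * x = a at *
    generalize T x * T y - T y * T x = b at *
    generalize T x * y - y * T x = c at *
    generalize x * T y - T y * x = d at *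
    simp only [map_add, map_sub] at h1 h2
    have h4 := congrArg₂ HSub.hSub h1 h2
    have h5 : (2 : ℂ) • (b + a - T c - T d) = (a + b + (c + d) - -(a + b - (c + d))) -
      (T a + T b + (T c + T d) - (T a + T b - (T c + T d))) := by
      module
    rw [h5, h4, sub_self]
  exact (smul_eq_zero.1 h3).resolve_left two_ne_zero

/-- If the product of two "triangular" matrices is formed, their commutator is strictly
triangular. -/
theorem commutator_apply_eq_zero {n R : Type*} [Fintype n] [CommRing R] {f : n → ℤ}
    (hf : Function.Injective f) {x y : Matrix n n R} (hx : ∀ p q, f q < f p → x p q = 0)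
    (hy : ∀ p q, f q < f p → y p q = 0) {p q : n} (hpq : f q ≤ f p) :
    (x * y - y * x) p q = 0 := by
  -- Only the index r = p contributes: an r below p kills x p r, and an r above p is also above q
  -- and kills y r q.
  have key (x y : Matrix n n R) (hx : ∀ p q, f q < f p → x p q = 0)
      (hy : ∀ p q, f q < f p → y p q = 0) : (x * y) p q = x p p * y p q := by
    rw [Matrix.mul_apply]
    refine Finset.sum_eq_single p (fun r _ hr => ?_) (by simp)
    rcases lt_or_gt_of_ne (hf.ne hr) with h | h
    · rw [hx p r h, zero_mul]
    · rw [hy r q (hpq.trans_lt h), mul_zero]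
  rw [Matrix.sub_apply, key x y hx hy, key y x hy hx]
  rcases hpq.lt_or_eq with h | h
  · rw [hx p q h, hy p q h, mul_zero, mul_zero, sub_zero]
  · rw [hf h, mul_comm, sub_self]

/-! ### The isometry of the scalar parts -/

namespace OddSl

variable {k : ℕ}

/-- The index set: `2k+1` elements, seen as `k` pairs and a single element. -/
abbrev Idx (k : ℕ) : Type := (Fin k × Fin 2) ⊕ Unit

/-- The matrices decomposed into `2 × 2` blocks, a column and a row of vectors. -/
abbrev Blocks (k : ℕ) : Type :=
  (Fin k → Fin k → Matrix (Fin 2) (Fin 2) ℂ) × (Fin k → Fin 2 → ℂ) × (Fin k → Fin 2 → ℂ)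

variable (k) in
/-- The square root of `2k+1`. -/
def root : ℝ := √(2 * k + 1)

theorem root_pos : 0 < root k := Real.sqrt_pos.2 (by positivity)

theorem root_sq : (root k : ℂ) ^ 2 = 2 * k + 1 := by
  have : root k ^ 2 = 2 * k + 1 := Real.sq_sqrt (by positivity)
  exact_mod_cast this

theorem root_ne_zero : (root k : ℂ) ≠ 0 := by exact_mod_cast root_pos.ne'

theorem root_add_one_ne_zero : (root k : ℂ) + 1 ≠ 0 := by
  exact_mod_cast (add_pos (root_pos (k := k)) one_pos).ne'

/-- Eliminating k makes the identities below rational in `root k`. -/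
theorem cast_eq : (k : ℂ) = ((root k : ℂ) ^ 2 - 1) / 2 := by
  rw [root_sq]
  ring

/-- A complex-linear map turning the form `2 ∑ sᵢ tᵢ + 4 (∑ sᵢ) (∑ tᵢ)` into `-2 ∑ sᵢ tᵢ`. -/
def twist (s : Fin k → ℂ) (i : Fin k) : ℂ :=
  -Complex.I * (s i + 2 / ((root k : ℂ) + 1) * ∑ j, s j)

/-- The inverse of `twist`. -/
def untwist (c : Fin k → ℂ) (i : Fin k) : ℂ :=
  Complex.I * (c i - 2 / ((root k : ℂ) * ((root k : ℂ) + 1)) * ∑ j, c j)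

theorem sum_twist (s : Fin k → ℂ) : ∑ i, twist s i = -Complex.I * (root k : ℂ) * ∑ i, s i := by
  have h0 := root_ne_zero (k := k)
  have h1 := root_add_one_ne_zero (k := k)
  simp only [twist, ← Finset.mul_sum, Finset.sum_add_distrib, Finset.sum_const, Finset.card_univ,
    Fintype.card_fin, nsmul_eq_mul]
  rw [cast_eq]
  field_simp
  ring

theorem sum_untwist (c : Fin k → ℂ) :
    ∑ i, untwist c i = Complex.I / (root k : ℂ) * ∑ i, c i := by
  have h0 := root_ne_zero (k := k)
  have h1 := root_add_one_ne_zero (k := k)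
  simp only [untwist, ← Finset.mul_sum, Finset.sum_sub_distrib, Finset.sum_const, Finset.card_univ,
    Fintype.card_fin, nsmul_eq_mul]
  rw [cast_eq]
  field_simp
  ring

theorem untwist_twist (s : Fin k → ℂ) : untwist (twist s) = s := by
  have h0 := root_ne_zero (k := k)
  have h1 := root_add_one_ne_zero (k := k)
  funext i
  rw [untwist, sum_twist, twist]
  field_simp
  linear_combination (-(s i * ((root k : ℂ) + 1))) * Complex.I_sq

theorem twist_untwist (c : Fin k → ℂ) : twist (untwist c) = c := by
  have h0 := root_ne_zero (k := k)
  have h1 := root_add_one_ne_zero (k := k)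
  funext i
  rw [twist, sum_untwist, untwist]
  field_simp
  linear_combination (-(c i * ((root k : ℂ) + 1) * (root k : ℂ))) * Complex.I_sq

/-- The constant in `twist` is a root α of 2α + kα² = 2: then 1 + αN, with N the all-ones matrix,
has square 1 + 2N, the Gram matrix of ½(2 ∑ sᵢtᵢ + 4 (∑ sᵢ)(∑ tᵢ)). With r = √(2k+1) this gives α =
2/(r+1). The factor -i changes the sign of the form. -/
theorem untwist_isometry (c d : Fin k → ℂ) :
    2 * ∑ i, untwist c i * untwist d i + 4 * (∑ i, untwist c i) * ∑ i, untwist d i =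
      -2 * ∑ i, c i * d i := by
  have h0 := root_ne_zero (k := k)
  have h1 := root_add_one_ne_zero (k := k)
  have h2 (i : Fin k) : untwist c i * untwist d i = -(c i * d i)
      + 2 / ((root k : ℂ) * ((root k : ℂ) + 1)) * (∑ j, d j) * c i
      + 2 / ((root k : ℂ) * ((root k : ℂ) + 1)) * (∑ j, c j) * d i
      - (2 / ((root k : ℂ) * ((root k : ℂ) + 1))) ^ 2 * (∑ j, c j) * (∑ j, d j) := by
    rw [untwist, untwist]
    linear_combination ((c i - 2 / ((root k : ℂ) * ((root k : ℂ) + 1)) * ∑ j, c j) *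
      (d i - 2 / ((root k : ℂ) * ((root k : ℂ) + 1)) * ∑ j, d j)) * Complex.I_sq
  rw [sum_untwist, sum_untwist]
  simp only [h2, Finset.sum_sub_distrib, Finset.sum_add_distrib, Finset.sum_neg_distrib,
    ← Finset.mul_sum, Finset.sum_const, Finset.card_univ, Fintype.card_fin, nsmul_eq_mul]
  rw [cast_eq]
  have h3 : Complex.I / (root k : ℂ) * (∑ i, c i) * (Complex.I / (root k : ℂ) * ∑ i, d i) =
    -((∑ i, c i) * (∑ i, d i) / (root k : ℂ) ^ 2) := by
    field_simp
    linear_combination ((∑ i, c i) * (∑ i, d i)) * Complex.I_sq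
  rw [mul_assoc 4, h3]
  field_simp
  ring

theorem twist_add (s t : Fin k → ℂ) : twist (s + t) = twist s + twist t := by
  funext i
  simp only [twist, Pi.add_apply, Finset.sum_add_distrib]
  ring

theorem twist_smul (a : ℂ) (s : Fin k → ℂ) : twist (a • s) = a • twist s := by
  funext i
  simp only [twist, Pi.smul_apply, smul_eq_mul, ← Finset.mul_sum]
  ring

theorem untwist_add (s t : Fin k → ℂ) : untwist (s + t) = untwist s + untwist t := by
  funext i
  simp only [untwist, Pi.add_apply, Finset.sum_add_distrib]
  ring

theorem untwist_smul (a : ℂ) (s : Fin k → ℂ) : untwist (a • s) = a • untwist s := by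
  funext i
  simp only [untwist, Pi.smul_apply, smul_eq_mul, ← Finset.mul_sum]
  ring

/-- Apart from the factor -i all coefficients are real, so imaginary vectors become real. This is
what makes the construction compatible with the real form su(k+1, k). -/
theorem star_twist {s : Fin k → ℂ} (hs : ∀ i, star (s i) = -s i) (i : Fin k) :
    star (twist s i) = twist s i := by
  simp only [twist, star_mul', star_neg, star_add, star_sum, hs, Finset.sum_neg_distrib]
  simp
  ring

theorem star_untwist {c : Fin k → ℂ} (hc : ∀ i, star (c i) = c i) (i : Fin k) :
    star (untwist c i) = -untwist c i := by
  simp only [untwist, star_mul', star_sub, star_sum, hc]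
  simp

end OddSl

/-! ### Twisted blocks, the action of 2 × 2 matrices and the trace form -/

namespace OddSl

variable {k : ℕ}

/-- The `(i, j)` block of size `2` of a matrix. -/
def block (x : Matrix (Idx k) (Idx k) ℂ) (i j : Fin k) : Matrix (Fin 2) (Fin 2) ℂ :=
  Matrix.of fun a b => x (.inl (i, a)) (.inl (j, b))

/-- The half traces of the diagonal blocks. -/
def halfTrace (A : Fin k → Fin k → Matrix (Fin 2) (Fin 2) ℂ) (i : Fin k) : ℂ :=
  (A i i).trace / 2

/-- The diagonal blocks are changed by the scalar matrices `c i`. -/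
def shift (A : Fin k → Fin k → Matrix (Fin 2) (Fin 2) ℂ) (c : Fin k → ℂ) (i j : Fin k) :
    Matrix (Fin 2) (Fin 2) ℂ :=
  if i = j then A i j + (c i - halfTrace A i) • 1 else A i j

theorem shift_self (A : Fin k → Fin k → Matrix (Fin 2) (Fin 2) ℂ) (c : Fin k → ℂ) (i : Fin k) :
    shift A c i i = A i i + (c i - halfTrace A i) • 1 := if_pos rfl

theorem shift_of_ne (A : Fin k → Fin k → Matrix (Fin 2) (Fin 2) ℂ) (c : Fin k → ℂ) {i j : Fin k}
    (h : i ≠ j) : shift A c i j = A i j := if_neg h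

theorem halfTrace_shift (A : Fin k → Fin k → Matrix (Fin 2) (Fin 2) ℂ) (c : Fin k → ℂ) :
    halfTrace (shift A c) = c := by
  funext i
  simp [halfTrace, shift_self, Matrix.trace_add, Matrix.trace_smul]
  ring

theorem halfTrace_add (A B : Fin k → Fin k → Matrix (Fin 2) (Fin 2) ℂ) :
    halfTrace (A + B) = halfTrace A + halfTrace B := by
  funext i
  simp [halfTrace, Matrix.trace_add, add_div]

theorem halfTrace_smul (z : ℂ) (A : Fin k → Fin k → Matrix (Fin 2) (Fin 2) ℂ) :
    halfTrace (z • A) = z • halfTrace A := by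
  funext i
  simp [halfTrace, Matrix.trace_smul, mul_div_assoc]

theorem shift_shift (A : Fin k → Fin k → Matrix (Fin 2) (Fin 2) ℂ) (c d : Fin k → ℂ) :
    shift (shift A c) d = shift A d := by
  funext i j
  rcases eq_or_ne i j with rfl | h
  · rw [shift_self, halfTrace_shift, shift_self, shift_self, add_assoc, ← add_smul]
    congr 2
    ring
  · rw [shift_of_ne _ _ h, shift_of_ne _ _ h, shift_of_ne _ _ h]

theorem shift_halfTrace (A : Fin k → Fin k → Matrix (Fin 2) (Fin 2) ℂ) :
    shift A (halfTrace A) = A := by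
  funext i j
  rcases eq_or_ne i j with rfl | h
  · rw [shift_self, sub_self, zero_smul, add_zero]
  · rw [shift_of_ne _ _ h]

theorem shift_add (A B : Fin k → Fin k → Matrix (Fin 2) (Fin 2) ℂ) (c d : Fin k → ℂ) :
    shift (A + B) (c + d) = shift A c + shift B d := by
  funext i j
  rcases eq_or_ne i j with rfl | h
  · simp only [shift_self, halfTrace_add, Pi.add_apply]
    module
  · simp only [shift_of_ne _ _ h, Pi.add_apply]

theorem shift_smul (z : ℂ) (A : Fin k → Fin k → Matrix (Fin 2) (Fin 2) ℂ) (c : Fin k → ℂ) :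
    shift (z • A) (z • c) = z • shift A c := by
  funext i j
  rcases eq_or_ne i j with rfl | h
  · simp only [shift_self, halfTrace_smul, Pi.smul_apply, smul_eq_mul]
    module
  · simp only [shift_of_ne _ _ h, Pi.smul_apply]

/-- The blocks of a matrix, where the half traces of the diagonal blocks are twisted. -/
def toBlocks : Matrix (Idx k) (Idx k) ℂ →ₗ[ℂ] Blocks k where
  toFun x := (shift (block x) (twist (halfTrace (block x))),
    fun i a => x (.inl (i, a)) (.inr ()), fun i a => x (.inr ()) (.inl (i, a)))
  map_add' x y := by
    have h : block (x + y) = block x + block y := rfl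
    simp only [h, halfTrace_add, twist_add, shift_add]
    rfl
  map_smul' z x := by
    have h : block (z • x) = z • block x := rfl
    simp only [h, halfTrace_smul, twist_smul, shift_smul]
    rfl

/-- The trace-free matrix with given twisted blocks. -/
def ofBlocks : Blocks k →ₗ[ℂ] Matrix (Idx k) (Idx k) ℂ where
  toFun X := Matrix.fromBlocks
    (Matrix.of fun p q => shift X.1 (untwist (halfTrace X.1)) p.1 q.1 p.2 q.2)
    (Matrix.of fun p _ => X.2.1 p.1 p.2) (Matrix.of fun _ q => X.2.2 q.1 q.2)
    (Matrix.of fun _ _ => -2 * ∑ i, untwist (halfTrace X.1) i)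
  map_add' X Y := by
    ext (p | p) (q | q) <;>
    simp [halfTrace_add, untwist_add, shift_add, Finset.sum_add_distrib, mul_add]
  map_smul' z X := by
    ext (p | p) (q | q) <;>
    simp [halfTrace_smul, untwist_smul, shift_smul, Finset.mul_sum, mul_left_comm]

theorem block_ofBlocks (X : Blocks k) :
    block (ofBlocks X) = shift X.1 (untwist (halfTrace X.1)) := rfl

theorem toBlocks_ofBlocks (X : Blocks k) : toBlocks (ofBlocks X) = X := by
  refine Prod.ext ?_ rfl
  change shift (block (ofBlocks X)) (twist (halfTrace (block (ofBlocks X)))) = _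
  rw [block_ofBlocks, halfTrace_shift, twist_untwist, shift_shift, shift_halfTrace]

theorem trace_eq (x : Matrix (Idx k) (Idx k) ℂ) :
    x.trace = 2 * ∑ i, halfTrace (block x) i + x (.inr ()) (.inr ()) := by
  simp only [Matrix.trace, Matrix.diag_apply, Fintype.sum_sum_type, Fintype.sum_prod_type, halfTrace,
    Finset.mul_sum, block]
  simp only [Fin.sum_univ_two, Matrix.of_apply, Finset.univ_unique,
    Finset.sum_singleton, PUnit.default_eq_unit]
  congr 1
  refine Finset.sum_congr rfl fun i _ => ?_
  ring

theorem trace_ofBlocks (X : Blocks k) : (ofBlocks X).trace = 0 := by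
  rw [trace_eq, block_ofBlocks, halfTrace_shift]
  simp [ofBlocks]

/-- The blocks forget only the corner entry, and `trace_eq` recovers it from the half traces when
the trace is zero. -/
theorem ofBlocks_toBlocks {x : Matrix (Idx k) (Idx k) ℂ} (hx : x.trace = 0) :
    ofBlocks (toBlocks x) = x := by
  have h1 : (toBlocks x).1 = shift (block x) (twist (halfTrace (block x))) := rfl
  have h2 : shift (toBlocks x).1 (untwist (halfTrace (toBlocks x).1)) = block x := by
    rw [h1, halfTrace_shift, untwist_twist, shift_shift, shift_halfTrace]
  rw [trace_eq] at hx
  ext (p | p) (q | q)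
  · exact congrFun₂ (congrFun₂ h2 p.1 q.1) p.2 q.2
  · rfl
  · rfl
  · change -2 * ∑ i, untwist (halfTrace (shift (block x) (twist (halfTrace (block x))))) i =
      x (.inr ()) (.inr ())
    rw [halfTrace_shift, untwist_twist]
    linear_combination -hx

/-- The action of a `2 × 2` matrix on the blocks. -/
def blockAct (B : Matrix (Fin 2) (Fin 2) ℂ) : Blocks k →ₗ[ℂ] Blocks k where
  toFun X := (fun i j => if i ≤ j then B * X.1 i j else X.1 i j * B.adjugate,
    fun i => B *ᵥ X.2.1 i, fun i => X.2.2 i ᵥ* B.adjugate)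
  map_add' X Y := by
    refine Prod.ext ?_ (Prod.ext ?_ ?_)
    · funext i j
      by_cases h : i ≤ j <;> simp [h, Matrix.mul_add, Matrix.add_mul]
    · funext i
      simp [Matrix.mulVec_add]
    · funext i
      simp [Matrix.add_vecMul]
  map_smul' z X := by
    refine Prod.ext ?_ (Prod.ext ?_ ?_)
    · funext i j
      by_cases h : i ≤ j <;> simp [h]
    · funext i
      simp [Matrix.mulVec_smul]
    · funext i
      simp [Matrix.smul_vecMul]

/-- The adjugate reverses products, so right multiplication by it is again a left action. -/
theorem blockAct_mul (B C : Matrix (Fin 2) (Fin 2) ℂ) (X : Blocks k) :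
    blockAct (B * C) X = blockAct B (blockAct C X) := by
  refine Prod.ext ?_ (Prod.ext ?_ ?_)
  · funext i j
    by_cases h : i ≤ j <;> simp [blockAct, h, Matrix.mul_assoc, Matrix.adjugate_mul_distrib]
  · funext i
    exact (Matrix.mulVec_mulVec (X.2.1 i) B C).symm
  · funext i
    simp [blockAct, Matrix.vecMul_vecMul, Matrix.adjugate_mul_distrib]

/-- Size two is essential: only there is the adjugate homogeneous of degree one. -/
theorem blockAct_smul (z : ℂ) (B : Matrix (Fin 2) (Fin 2) ℂ) (X : Blocks k) :
    blockAct (z • B) X = z • blockAct B X := by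
  refine Prod.ext ?_ (Prod.ext ?_ ?_)
  · funext i j
    by_cases h : i ≤ j <;> simp [blockAct, h, Matrix.adjugate_smul]
  · funext i
    simp [blockAct, Matrix.smul_mulVec]
  · funext i
    simp [blockAct, Matrix.vecMul_smul, Matrix.adjugate_smul]

theorem blockAct_one (X : Blocks k) : blockAct 1 X = X := by
  refine Prod.ext ?_ (Prod.ext ?_ ?_)
  · funext i j
    simp [blockAct]
  · funext i
    simp [blockAct]
  · funext i
    simp [blockAct]

/-- The action of a `2 × 2` matrix on matrices of size `2k+1`. -/
def act (B : Matrix (Fin 2) (Fin 2) ℂ) :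
    Matrix (Idx k) (Idx k) ℂ →ₗ[ℂ] Matrix (Idx k) (Idx k) ℂ :=
  ofBlocks ∘ₗ blockAct B ∘ₗ toBlocks

theorem act_apply (B : Matrix (Fin 2) (Fin 2) ℂ) (x : Matrix (Idx k) (Idx k) ℂ) :
    act B x = ofBlocks (blockAct B (toBlocks x)) := rfl

theorem trace_act (B : Matrix (Fin 2) (Fin 2) ℂ) (x : Matrix (Idx k) (Idx k) ℂ) :
    (act B x).trace = 0 := trace_ofBlocks _

theorem act_act (B C : Matrix (Fin 2) (Fin 2) ℂ) (x : Matrix (Idx k) (Idx k) ℂ) :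
    act B (act C x) = act (B * C) x := by
  simp only [act_apply, toBlocks_ofBlocks, blockAct_mul]

theorem act_smul (z : ℂ) (B : Matrix (Fin 2) (Fin 2) ℂ) (x : Matrix (Idx k) (Idx k) ℂ) :
    act (z • B) x = z • act B x := by
  rw [act_apply, blockAct_smul, map_smul, act_apply]

theorem act_one {x : Matrix (Idx k) (Idx k) ℂ} (hx : x.trace = 0) : act 1 x = x := by
  rw [act_apply, blockAct_one, ofBlocks_toBlocks hx]

/-- The trace form in terms of twisted blocks. -/
def blockForm (X Y : Blocks k) : ℂ :=
  (∑ i, ∑ j, if i = j then -(X.1 i j * (Y.1 j i).adjugate).trace else (X.1 i j * Y.1 j i).trace) +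
    ∑ i, (X.2.2 i ⬝ᵥ Y.2.1 i + Y.2.2 i ⬝ᵥ X.2.1 i)

/-- On diagonal blocks the trace-free parts contribute equally to both sides. The scalar parts and
the corner together contribute the left side of `untwist_isometry`, whose right side is the scalar
contribution to -tr(A adj A'). -/
theorem trace_ofBlocks_mul (X Y : Blocks k) :
    (ofBlocks X * ofBlocks Y).trace = blockForm X Y := by
  have h1 (x y : Matrix (Idx k) (Idx k) ℂ) : (x * y).trace =
      (∑ i, ∑ j, (block x i j * block y j i).trace) +
      (∑ i, ((toBlocks x).2.2 i ⬝ᵥ (toBlocks y).2.1 i + (toBlocks y).2.2 i ⬝ᵥ (toBlocks x).2.1 i)) +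
      x (.inr ()) (.inr ()) * y (.inr ()) (.inr ()) := by
    simp only [Matrix.trace, Matrix.diag_apply, Matrix.mul_apply, Fintype.sum_sum_type,
      Fintype.sum_prod_type, block, toBlocks, LinearMap.coe_mk, AddHom.coe_mk, dotProduct,
      Finset.sum_add_distrib, Fin.sum_univ_two, Matrix.of_apply, Finset.univ_unique,
      Finset.sum_singleton, PUnit.default_eq_unit, mul_comm]
    ring
  rw [h1, toBlocks_ofBlocks, toBlocks_ofBlocks, block_ofBlocks, block_ofBlocks, blockForm]
  have h2 (X : Blocks k) : ofBlocks X (.inr ()) (.inr ()) =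
    -2 * ∑ i, untwist (halfTrace X.1) i := rfl
  rw [h2, h2]
  have h3 (i j : Fin k) : (shift X.1 (untwist (halfTrace X.1)) i j *
      shift Y.1 (untwist (halfTrace Y.1)) j i).trace =
      (if i = j then -(X.1 i j * (Y.1 j i).adjugate).trace else (X.1 i j * Y.1 j i).trace) +
      (if i = j then 2 * (untwist (halfTrace X.1) i * untwist (halfTrace Y.1) i) +
        2 * (halfTrace X.1 i * halfTrace Y.1 i) else 0) := by
    rcases eq_or_ne i j with rfl | h
    · rw [shift_self, shift_self, if_pos rfl, if_pos rfl]
      generalize untwist (halfTrace X.1) i = c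
      generalize untwist (halfTrace Y.1) i = d
      simp only [halfTrace]
      generalize X.1 i i = A
      generalize Y.1 i i = B
      simp [Matrix.trace_fin_two, Matrix.mul_apply, Fin.sum_univ_two, Matrix.adjugate_fin_two]
      ring
    · rw [shift_of_ne _ _ h, shift_of_ne _ _ h.symm, if_neg h, if_neg h, add_zero]
  simp only [h3, Finset.sum_add_distrib, Finset.sum_ite_eq, Finset.mem_univ, if_true]
  have h4 := untwist_isometry (halfTrace X.1) (halfTrace Y.1)
  rw [← Finset.mul_sum, ← Finset.mul_sum]
  linear_combination h4

/-- In each pair (i, j), (j, i) with i ≠ j one block is multiplied by B on the left and the other by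
adj(B) on the right. On the diagonal the adjugate inside the form turns the second left factor B
into a right factor adj(B). In every case adj(B)B = det B appears. -/
theorem blockForm_blockAct (B : Matrix (Fin 2) (Fin 2) ℂ) (X Y : Blocks k) :
    blockForm (blockAct B X) (blockAct B Y) = B.det * blockForm X Y := by
  have hv (ξ v : Fin 2 → ℂ) : (ξ ᵥ* B.adjugate) ⬝ᵥ (B *ᵥ v) = B.det * (ξ ⬝ᵥ v) := by
    rw [← Matrix.dotProduct_mulVec, Matrix.mulVec_mulVec, Matrix.adjugate_mul, Matrix.smul_mulVec,
      Matrix.one_mulVec, dotProduct_smul, smul_eq_mul]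
  have ht (C : Matrix (Fin 2) (Fin 2) ℂ) : (B * C * B.adjugate).trace = B.det * C.trace := by
    rw [Matrix.trace_mul_comm, ← Matrix.mul_assoc, Matrix.adjugate_mul, Matrix.smul_mul,
      Matrix.one_mul, Matrix.trace_smul, smul_eq_mul]
  simp only [blockForm, blockAct, LinearMap.coe_mk, AddHom.coe_mk, hv, mul_add, Finset.mul_sum]
  congr 1
  refine Finset.sum_congr rfl fun i _ => Finset.sum_congr rfl fun j _ => ?_
  rcases lt_trichotomy i j with h | rfl | h
  · rw [if_neg h.ne, if_neg h.ne, if_pos h.le, if_neg h.not_ge, ← Matrix.mul_assoc,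
      Matrix.mul_assoc B, ht]
  · rw [if_pos rfl, if_pos rfl, if_pos le_rfl, if_pos le_rfl, Matrix.adjugate_mul_distrib,
      ← Matrix.mul_assoc, Matrix.mul_assoc B, ht, mul_neg]
  · rw [if_neg h.ne', if_neg h.ne', if_neg h.not_ge, if_pos h.le, Matrix.mul_assoc,
      ← Matrix.mul_assoc _ B, Matrix.adjugate_mul, Matrix.smul_mul, Matrix.one_mul, Matrix.mul_smul,
      Matrix.trace_smul, smul_eq_mul]

theorem trace_act_mul (B : Matrix (Fin 2) (Fin 2) ℂ) {x y : Matrix (Idx k) (Idx k) ℂ}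
    (hx : x.trace = 0) (hy : y.trace = 0) : (act B x * act B y).trace = B.det * (x * y).trace := by
  rw [act_apply, act_apply, trace_ofBlocks_mul, blockForm_blockAct, ← trace_ofBlocks_mul,
    ofBlocks_toBlocks hx, ofBlocks_toBlocks hy]

end OddSl

/-! ### Integrability of the two structures -/

namespace OddSl

variable {k : ℕ}

/-- The block-diagonal matrix with `k` blocks `s` and one block `1`. -/
def diagBlocks (s : Matrix (Fin 2) (Fin 2) ℂ) : Matrix (Idx k) (Idx k) ℂ :=
  Matrix.fromBlocks (Matrix.of fun p q => if p.1 = q.1 then s p.2 q.2 else 0) 0 0 1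

theorem diagBlocks_mul_inl (s : Matrix (Fin 2) (Fin 2) ℂ) (x : Matrix (Idx k) (Idx k) ℂ)
    (i : Fin k) (a : Fin 2) (q : Idx k) :
    (diagBlocks s * x : Matrix (Idx k) (Idx k) ℂ) (.inl (i, a)) q = ∑ c, s a c * x (.inl (i, c)) q := by
  simp only [Matrix.mul_apply, Fintype.sum_sum_type, Fintype.sum_prod_type, diagBlocks,
    Matrix.fromBlocks_apply₁₁, Matrix.fromBlocks_apply₁₂, Matrix.of_apply, Matrix.zero_apply,
    zero_mul, Finset.sum_const_zero, add_zero]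
  rw [Finset.sum_eq_single i (fun j _ hj => by simp [hj.symm]) (by simp)]
  simp

theorem diagBlocks_mul_inr (s : Matrix (Fin 2) (Fin 2) ℂ) (x : Matrix (Idx k) (Idx k) ℂ)
    (q : Idx k) : (diagBlocks s * x : Matrix (Idx k) (Idx k) ℂ) (.inr ()) q = x (.inr ()) q := by
  simp [Matrix.mul_apply, diagBlocks]

theorem mul_diagBlocks_inl (s : Matrix (Fin 2) (Fin 2) ℂ) (x : Matrix (Idx k) (Idx k) ℂ)
    (p : Idx k) (j : Fin k) (b : Fin 2) :
    (x * diagBlocks s : Matrix (Idx k) (Idx k) ℂ) p (.inl (j, b)) = ∑ c, x p (.inl (j, c)) * s c b := by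
  simp only [Matrix.mul_apply, Fintype.sum_sum_type, Fintype.sum_prod_type, diagBlocks,
    Matrix.fromBlocks_apply₁₁, Matrix.fromBlocks_apply₂₁, Matrix.of_apply, Matrix.zero_apply,
    mul_zero, Finset.sum_const_zero, add_zero]
  rw [Finset.sum_eq_single j (fun i _ hi => by simp [hi]) (by simp)]
  simp

theorem mul_diagBlocks_inr (s : Matrix (Fin 2) (Fin 2) ℂ) (x : Matrix (Idx k) (Idx k) ℂ)
    (p : Idx k) : (x * diagBlocks s : Matrix (Idx k) (Idx k) ℂ) p (.inr ()) = x p (.inr ()) := by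
  simp [Matrix.mul_apply, diagBlocks]

theorem diagBlocks_mul_diagBlocks {s t : Matrix (Fin 2) (Fin 2) ℂ} (h : s * t = 1) :
    (diagBlocks s * diagBlocks t : Matrix (Idx k) (Idx k) ℂ) = 1 := by
  ext (⟨i, a⟩ | p) (⟨j, b⟩ | q)
  · rw [diagBlocks_mul_inl]
    rcases eq_or_ne i j with rfl | hij
    · have := congrFun₂ h a b
      rw [Matrix.mul_apply] at this
      simp [diagBlocks, this, Matrix.one_apply]
    · simp [diagBlocks, hij]
  · rw [diagBlocks_mul_inl]
    simp [diagBlocks]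
  · rw [diagBlocks_mul_inr]
    simp [diagBlocks]
  · rw [diagBlocks_mul_inr]
    simp [diagBlocks]

/-- Conjugation on the level of blocks. -/
def conjBlocks (s t : Matrix (Fin 2) (Fin 2) ℂ) (X : Blocks k) : Blocks k :=
  (fun i j => s * X.1 i j * t, fun i => s *ᵥ X.2.1 i, fun i => X.2.2 i ᵥ* t)

theorem toBlocks_conj {s t : Matrix (Fin 2) (Fin 2) ℂ} (hst : s * t = 1)
    (x : Matrix (Idx k) (Idx k) ℂ) :
    toBlocks (diagBlocks s * x * diagBlocks t) = conjBlocks s t (toBlocks x) := by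
  have hts : t * s = 1 := mul_eq_one_comm.1 hst
  have hb : block (diagBlocks s * x * diagBlocks t) = fun i j => s * block x i j * t := by
    funext i j
    ext a b
    rw [block, Matrix.of_apply, mul_diagBlocks_inl]
    simp only [diagBlocks_mul_inl]
    simp only [Matrix.mul_apply, block, Matrix.of_apply]
  have hh : halfTrace (fun i j => s * block x i j * t) = halfTrace (block x) := by
    funext i
    rw [halfTrace, halfTrace, Matrix.trace_mul_comm, ← Matrix.mul_assoc, hts, Matrix.one_mul]
  refine Prod.ext ?_ (Prod.ext ?_ ?_)
  · change shift _ (twist (halfTrace _)) = fun i j => s * shift _ _ i j * t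
    rw [hb, hh]
    funext i j
    rcases eq_or_ne i j with rfl | h
    · rw [shift_self, shift_self, hh, Matrix.mul_add, Matrix.add_mul, Matrix.mul_smul,
        Matrix.smul_mul, Matrix.mul_one, hst]
    · rw [shift_of_ne _ _ h, shift_of_ne _ _ h]
  · funext i a
    exact (mul_diagBlocks_inr _ _ _).trans (diagBlocks_mul_inl _ _ _ _ _)
  · funext i b
    refine (mul_diagBlocks_inl _ _ _ _ _).trans ?_
    simp only [diagBlocks_mul_inr]
    rfl

theorem trace_conj {s t : Matrix (Fin 2) (Fin 2) ℂ} (hst : s * t = 1)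
    (x : Matrix (Idx k) (Idx k) ℂ) :
    (diagBlocks s * x * diagBlocks t).trace = x.trace := by
  rw [Matrix.trace_mul_comm, ← Matrix.mul_assoc,
    diagBlocks_mul_diagBlocks (mul_eq_one_comm.1 hst), Matrix.one_mul]

/-- Block-diagonal conjugation preserves the half traces and fixes scalar blocks, so it commutes
with the twist and conjugates the acting matrix. -/
theorem act_conj {s t B C : Matrix (Fin 2) (Fin 2) ℂ} (hst : s * t = 1) (hC : C * s = s * B)
    (hC' : t * C.adjugate = B.adjugate * t) (x : Matrix (Idx k) (Idx k) ℂ) :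
    act C (diagBlocks s * x * diagBlocks t) = diagBlocks s * act B x * diagBlocks t := by
  rw [act_apply, toBlocks_conj hst, ← ofBlocks_toBlocks (x := diagBlocks s * act B x * diagBlocks t)
    ((trace_conj hst _).trans (trace_act _ _)), toBlocks_conj hst, act_apply, toBlocks_ofBlocks]
  congr 1
  refine Prod.ext ?_ (Prod.ext ?_ ?_)
  · funext i j
    by_cases h : i ≤ j
    · simp [blockAct, conjBlocks, h, ← Matrix.mul_assoc, hC]
    · simp [blockAct, conjBlocks, h, Matrix.mul_assoc, hC']
  · funext i
    change C *ᵥ (s *ᵥ _) = s *ᵥ (B *ᵥ _)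
    rw [Matrix.mulVec_mulVec, hC, Matrix.mulVec_mulVec]
  · funext i
    simp [blockAct, conjBlocks, hC']

/-- The position of an index in the order adapted to the action of `diagonal ![1, -1]`. -/
def rank : Idx k → ℤ
  | .inl (i, a) => if a = 0 then i - k else k - i
  | .inr _ => 0

/-- The increasing order is (0,0), …, (k-1,0), the single index, (k-1,1), …, (0,1). -/
theorem rank_injective : Function.Injective (rank (k := k)) := by
  rintro (⟨i, a⟩ | p) (⟨j, b⟩ | q) h
  · fin_cases a <;> fin_cases b <;> simp [rank] at h ⊢ <;> omega
  · fin_cases a <;> simp [rank] at h <;> omega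
  · fin_cases b <;> simp [rank] at h <;> omega
  · rfl

/-- The diagonal matrix with entries `1`, `-1`. -/
def diagOp : Matrix (Fin 2) (Fin 2) ℂ := Matrix.diagonal ![1, -1]

theorem adjugate_diagOp : diagOp.adjugate = -diagOp := by
  rw [Matrix.adjugate_fin_two]
  ext a b
  fin_cases a <;> fin_cases b <;> simp [diagOp]

theorem shift_apply_of_ne (A : Fin k → Fin k → Matrix (Fin 2) (Fin 2) ℂ) (c : Fin k → ℂ)
    {i j : Fin k} {a b : Fin 2} (h : (i, a) ≠ (j, b)) : shift A c i j a b = A i j a b := by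
  rcases eq_or_ne i j with rfl | hij
  · have hab : a ≠ b := fun hab => h (by rw [hab])
    rw [shift_self]
    simp [hab]
  · rw [shift_of_ne _ _ hij]

theorem act_diagOp_inl_inl (x : Matrix (Idx k) (Idx k) ℂ) {i j : Fin k} {a b : Fin 2}
    (h : (i, a) ≠ (j, b)) : act diagOp x (.inl (i, a)) (.inl (j, b)) =
      (if i ≤ j then ![1, -1] a else -![1, -1] b) * x (.inl (i, a)) (.inl (j, b)) := by
  refine (shift_apply_of_ne _ _ h).trans ?_
  have h1 : (toBlocks x).1 i j a b = x (.inl (i, a)) (.inl (j, b)) := shift_apply_of_ne _ _ h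
  rw [← h1]
  by_cases hij : i ≤ j
  · simp [blockAct, hij, diagOp, Matrix.diagonal_mul]
  · simp [blockAct, hij, adjugate_diagOp]
    simp [diagOp, Matrix.mul_diagonal, mul_comm]

theorem act_diagOp_inl_inr (x : Matrix (Idx k) (Idx k) ℂ) (i : Fin k) (a : Fin 2) :
    act diagOp x (.inl (i, a)) (.inr ()) = ![1, -1] a * x (.inl (i, a)) (.inr ()) := by
  change (diagOp *ᵥ fun a => x (.inl (i, a)) (.inr ())) a = _
  rw [diagOp, Matrix.mulVec_diagonal]

theorem act_diagOp_inr_inl (x : Matrix (Idx k) (Idx k) ℂ) (i : Fin k) (a : Fin 2) :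
    act diagOp x (.inr ()) (.inl (i, a)) = -![1, -1] a * x (.inr ()) (.inl (i, a)) := by
  change ((fun a => x (.inr ()) (.inl (i, a))) ᵥ* diagOp.adjugate) a = _
  rw [adjugate_diagOp, Matrix.vecMul_neg, Pi.neg_apply, diagOp, Matrix.vecMul_diagonal]
  ring

/-- The sign of an entry is read from its row when i ≤ j and from its column when j < i; in the
order of `rank` this says exactly that entries above the diagonal get +1. -/
theorem act_diagOp_of_lt (x : Matrix (Idx k) (Idx k) ℂ) {p q : Idx k} (h : rank p < rank q) :
    act diagOp x p q = x p q := by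
  rcases p with ⟨i, a⟩ | ⟨⟩ <;> rcases q with ⟨j, b⟩ | ⟨⟩
  · rw [act_diagOp_inl_inl _ (fun e => h.ne (by rw [e]))]
    fin_cases a <;> fin_cases b <;> by_cases hij : i ≤ j <;> simp [rank, hij] at h ⊢ <;> omega
  · rw [act_diagOp_inl_inr]
    fin_cases a <;> simp [rank] at h ⊢; omega
  · rw [act_diagOp_inr_inl]
    fin_cases b <;> simp [rank] at h ⊢; omega
  · exact (lt_irrefl _ h).elim

theorem act_diagOp_of_gt (x : Matrix (Idx k) (Idx k) ℂ) {p q : Idx k} (h : rank q < rank p) :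
    act diagOp x p q = -x p q := by
  rcases p with ⟨i, a⟩ | ⟨⟩ <;> rcases q with ⟨j, b⟩ | ⟨⟩
  · rw [act_diagOp_inl_inl _ (fun e => h.ne (by rw [e]))]
    fin_cases a <;> fin_cases b <;> by_cases hij : i ≤ j <;> simp [rank, hij] at h ⊢ <;> omega
  · rw [act_diagOp_inl_inr]
    fin_cases a <;> simp [rank] at h ⊢; omega
  · rw [act_diagOp_inr_inl]
    fin_cases b <;> simp [rank] at h ⊢; omega
  · exact (lt_irrefl _ h).elim

/-- Diagonal entries are mixed by the twist and have no definite sign. For a zero diagonal all half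
traces vanish and the twist disappears. -/
theorem act_diagOp_diag {x : Matrix (Idx k) (Idx k) ℂ} (hx : ∀ p, x p p = 0) (p : Idx k) :
    act diagOp x p p = 0 := by
  have h0 : halfTrace (block x) = 0 := by
    funext i
    simp [halfTrace, block, Matrix.trace_fin_two, hx]
  have t0 : twist (0 : Fin k → ℂ) = 0 := by
    funext i
    simp [twist]
  have u0 : untwist (0 : Fin k → ℂ) = 0 := by
    funext i
    simp [untwist]
  have h1 : (toBlocks x).1 = block x := by
    change shift (block x) (twist (halfTrace (block x))) = _
    rw [h0, t0, ← h0, shift_halfTrace]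
  have h2 (i : Fin k) (a : Fin 2) : (blockAct diagOp (toBlocks x)).1 i i a a = 0 := by
    simp [blockAct, h1, diagOp, Matrix.diagonal_mul, block, hx]
  have h3 : halfTrace (blockAct diagOp (toBlocks x)).1 = 0 := by
    funext i
    simp [halfTrace, Matrix.trace_fin_two, h2]
  rcases p with ⟨i, a⟩ | ⟨⟩
  · change shift (blockAct diagOp (toBlocks x)).1
      (untwist (halfTrace (blockAct diagOp (toBlocks x)).1)) i i a a = 0
    rw [h3, u0, ← h3, shift_halfTrace, h2]
  · change -2 * ∑ i, untwist (halfTrace (blockAct diagOp (toBlocks x)).1) i = 0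
    rw [h3, u0]
    simp

theorem diagOp_mul_self : diagOp * diagOp = 1 := by
  rw [diagOp, Matrix.diagonal_mul_diagonal, ← Matrix.diagonal_one]
  congr 1
  funext a
  fin_cases a <;> simp

/-- Elements of the +1 eigenspace are upper triangular and those of the -1 eigenspace lower
triangular for `rank`. Their commutators are strictly triangular, where the operator is the scalar
±1, so the unknown behaviour on the diagonal plays no role. -/
theorem nijenhuis_act_diagOp {x y : Matrix (Idx k) (Idx k) ℂ} (hx : x.trace = 0)
    (hy : y.trace = 0) :
    (act diagOp x * act diagOp y - act diagOp y * act diagOp x) + (x * y - y * x)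
      - act diagOp (act diagOp x * y - y * act diagOp x)
      - act diagOp (x * act diagOp y - act diagOp y * x) = 0 := by
  refine nijenhuis_eq_zero_of_eigenspaces (LinearMap.ker (Matrix.traceLinearMap (Idx k) ℂ ℂ))
    (act diagOp) (trace_act _) ?_ ?_ ?_ hx hy
  · intro x hx
    rw [act_act, diagOp_mul_self, act_one hx]
  · intro x _ y _ hx hy
    have key {z : Matrix (Idx k) (Idx k) ℂ} (hz : act diagOp z = z) (p q : Idx k)
        (h : rank q < rank p) : z p q = 0 :=
      self_eq_neg.1 ((congrFun₂ hz p q).symm.trans (act_diagOp_of_gt z h))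
    have hc (p q : Idx k) (h : rank q ≤ rank p) : (x * y - y * x) p q = 0 :=
      commutator_apply_eq_zero rank_injective (key hx) (key hy) h
    ext p q
    rcases lt_trichotomy (rank p) (rank q) with h | h | h
    · exact act_diagOp_of_lt _ h
    · obtain rfl := rank_injective h
      rw [act_diagOp_diag fun p => hc p p le_rfl, hc p p le_rfl]
    · rw [act_diagOp_of_gt _ h, hc p q h.le, neg_zero]
  · intro x _ y _ hx hy
    have key {z : Matrix (Idx k) (Idx k) ℂ} (hz : act diagOp z = -z) (p q : Idx k)
        (h : -rank q < -rank p) : z p q = 0 :=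
      self_eq_neg.1 ((act_diagOp_of_lt z (neg_lt_neg_iff.1 h)).symm.trans (congrFun₂ hz p q))
    have hc (p q : Idx k) (h : rank p ≤ rank q) : (x * y - y * x) p q = 0 :=
      commutator_apply_eq_zero (f := fun p => -rank p) (neg_injective.comp rank_injective) (key hx)
        (key hy) (neg_le_neg h)
    ext p q
    rcases lt_trichotomy (rank p) (rank q) with h | h | h
    · rw [act_diagOp_of_lt _ h, Matrix.neg_apply, hc p q h.le, neg_zero]
    · obtain rfl := rank_injective h
      rw [act_diagOp_diag fun p => hc p p le_rfl, Matrix.neg_apply, hc p p le_rfl, neg_zero]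
    · exact act_diagOp_of_gt _ h

/-- The permutation matrix of size `2`. -/
def swapOp : Matrix (Fin 2) (Fin 2) ℂ := !![0, 1; 1, 0]

/-- `i` times `diagOp`. -/
def complexOp : Matrix (Fin 2) (Fin 2) ℂ := Complex.I • diagOp

theorem adjugate_swapOp : swapOp.adjugate = -swapOp := by
  rw [Matrix.adjugate_fin_two]
  ext a b
  fin_cases a <;> fin_cases b <;> simp [swapOp]

theorem adjugate_complexOp : complexOp.adjugate = -complexOp := by
  rw [complexOp, Matrix.adjugate_smul, adjugate_diagOp]
  simp

theorem diagOp_eq : diagOp = !![1, 0; 0, -1] := by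
  ext a b
  fin_cases a <;> fin_cases b <;> simp [diagOp]

theorem nijenhuis_act_swapOp {x y : Matrix (Idx k) (Idx k) ℂ} (hx : x.trace = 0)
    (hy : y.trace = 0) :
    (act swapOp x * act swapOp y - act swapOp y * act swapOp x) + (x * y - y * x)
      - act swapOp (act swapOp x * y - y * act swapOp x)
      - act swapOp (x * act swapOp y - act swapOp y * x) = 0 := by
  -- The columns are eigenvectors of `swapOp` for 1 and -1.
  let s : Matrix (Fin 2) (Fin 2) ℂ := !![1, -1; 1, 1]
  let t : Matrix (Fin 2) (Fin 2) ℂ := !![1 / 2, 1 / 2; -(1 / 2), 1 / 2]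
  have hst : s * t = 1 := by
    rw [Matrix.mul_fin_two, Matrix.one_fin_two]
    norm_num
  have hts : t * s = 1 := mul_eq_one_comm.1 hst
  have hC : swapOp * s = s * diagOp := by
    rw [diagOp_eq, swapOp, Matrix.mul_fin_two, Matrix.mul_fin_two]
    norm_num
  have hC' : t * swapOp.adjugate = diagOp.adjugate * t := by
    rw [adjugate_swapOp, adjugate_diagOp, diagOp_eq, swapOp, Matrix.mul_neg, Matrix.neg_mul,
      Matrix.mul_fin_two, Matrix.mul_fin_two]
    norm_num
  let S : Matrix (Idx k) (Idx k) ℂ := diagBlocks s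
  let T : Matrix (Idx k) (Idx k) ℂ := diagBlocks t
  have hTS : T * S = 1 := diagBlocks_mul_diagBlocks hts
  have hST : S * T = 1 := diagBlocks_mul_diagBlocks hst
  have hc (z : Matrix (Idx k) (Idx k) ℂ) : act swapOp (S * z * T) = S * act diagOp z * T :=
    act_conj hst hC hC' z
  have hm (z w : Matrix (Idx k) (Idx k) ℂ) : (S * z * T) * (S * w * T) = S * (z * w) * T := by
    calc (S * z * T) * (S * w * T) = S * z * (T * S) * w * T := by simp only [Matrix.mul_assoc]
      _ = _ := by rw [hTS, Matrix.mul_one, Matrix.mul_assoc S]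
  have hs (z w : Matrix (Idx k) (Idx k) ℂ) : S * z * T - S * w * T = S * (z - w) * T := by
    rw [Matrix.mul_sub, Matrix.sub_mul]
  have ha (z w : Matrix (Idx k) (Idx k) ℂ) : S * z * T + S * w * T = S * (z + w) * T := by
    rw [Matrix.mul_add, Matrix.add_mul]
  have hz (z : Matrix (Idx k) (Idx k) ℂ) (h : z.trace = 0) :
      ∃ w, w.trace = 0 ∧ z = S * w * T := by
    refine ⟨T * z * S, (trace_conj hts z).trans h, ?_⟩
    calc z = (S * T) * z * (S * T) := by rw [hST, Matrix.one_mul, Matrix.mul_one]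
      _ = _ := by simp only [Matrix.mul_assoc]
  obtain ⟨x, hx', rfl⟩ := hz x hx
  obtain ⟨y, hy', rfl⟩ := hz y hy
  simp only [hc, hm, hs, ha]
  rw [nijenhuis_act_diagOp hx' hy', Matrix.mul_zero, Matrix.zero_mul]

theorem isTracelessComplexProduct :
    IsTracelessComplexProduct (act (k := k) swapOp) (act complexOp) where
  trace_product := trace_act _
  trace_complex := trace_act _
  product_sq x hx := by
    have : swapOp * swapOp = 1 := by
      rw [swapOp, Matrix.mul_fin_two, Matrix.one_fin_two]
      norm_num
    rw [act_act, this, act_one hx]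
  complex_sq x hx := by
    have : complexOp * complexOp = (-1 : ℂ) • 1 := by
      rw [complexOp, smul_mul_smul_comm, diagOp_mul_self, Complex.I_mul_I]
    rw [act_act, this, act_smul, act_one hx, neg_one_smul]
  anticomm x _ := by
    have : swapOp * complexOp = (-1 : ℂ) • (complexOp * swapOp) := by
      rw [complexOp, diagOp_eq, swapOp, Matrix.mul_smul, Matrix.smul_mul, Matrix.mul_fin_two,
        Matrix.mul_fin_two]
      ext a b
      fin_cases a <;> fin_cases b <;> simp
    rw [act_act, this, act_smul, act_act, neg_one_smul]
  nijenhuis_product _ _ := nijenhuis_act_swapOp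
  nijenhuis_complex x y hx hy := by
    have h := nijenhuis_act_diagOp hx hy
    -- As the action is complex-linear, the factor i² turns the expression for `complexOp` with sign
    -- -1 into minus the one for `diagOp` with sign +1.
    have hI (z : Matrix (Idx k) (Idx k) ℂ) : act complexOp z = Complex.I • act diagOp z :=
      act_smul _ _ _
    simp only [hI, Matrix.smul_mul, Matrix.mul_smul, ← smul_sub, map_smul, smul_smul,
      Complex.I_mul_I]
    rw [← neg_eq_zero, ← h]
    module
  trace_product_mul x y hx hy := by
    rw [trace_act_mul _ hx hy, swapOp, Matrix.det_fin_two_of]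
    ring
  trace_complex_mul x y hx hy := by
    rw [trace_act_mul _ hx hy, complexOp, diagOp_eq, Matrix.det_smul, Matrix.det_fin_two_of]
    simp

end OddSl

/-! ### Transport along trace-preserving algebra isomorphisms -/

theorem IsTracelessComplexProduct.conj {n n' : Type*} [Fintype n] [Fintype n'] [DecidableEq n]
    [DecidableEq n'] {P J : Matrix n n ℂ →ₗ[ℂ] Matrix n n ℂ} (h : IsTracelessComplexProduct P J)
    (φ : Matrix n' n' ℂ ≃ₐ[ℂ] Matrix n n ℂ) (hφ : ∀ x, (φ x).trace = x.trace) :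
    IsTracelessComplexProduct (φ.toLinearEquiv.symm.conj P) (φ.toLinearEquiv.symm.conj J) := by
  have hψ (x : Matrix n n ℂ) : (φ.symm x).trace = x.trace := by rw [← hφ, φ.apply_symm_apply]
  have hc (T : Matrix n n ℂ →ₗ[ℂ] Matrix n n ℂ) (x : Matrix n' n' ℂ) :
      φ.toLinearEquiv.symm.conj T x = φ.symm (T (φ x)) := rfl
  have hz (x : Matrix n' n' ℂ) (hx : x.trace = 0) : (φ x).trace = 0 := (hφ x).trans hx
  constructor
  · exact fun x => (hψ _).trans (h.trace_product _)
  · exact fun x => (hψ _).trans (h.trace_complex _)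
  · intro x hx
    rw [hc, hc, φ.apply_symm_apply, h.product_sq _ (hz x hx), φ.symm_apply_apply]
  · intro x hx
    rw [hc, hc, φ.apply_symm_apply, h.complex_sq _ (hz x hx), map_neg, φ.symm_apply_apply]
  · intro x hx
    simp only [hc, φ.apply_symm_apply]
    rw [h.anticomm _ (hz x hx), map_neg]
  · intro x y hx hy
    apply φ.injective
    simpa only [hc, map_add, map_sub, map_mul, φ.apply_symm_apply, map_zero] using
      h.nijenhuis_product _ _ (hz x hx) (hz y hy)
  · intro x y hx hy
    apply φ.injective
    simpa only [hc, map_sub, map_mul, φ.apply_symm_apply, map_zero] using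
      h.nijenhuis_complex _ _ (hz x hx) (hz y hy)
  · intro x y hx hy
    rw [hc, hc, ← map_mul, hψ, h.trace_product_mul _ _ (hz x hx) (hz y hy), ← map_mul, hφ]
  · intro x y hx hy
    rw [hc, hc, ← map_mul, hψ, h.trace_complex_mul _ _ (hz x hx) (hz y hy), ← map_mul, hφ]

theorem trace_reindexAlgEquiv {n n' : Type*} [Fintype n] [Fintype n'] [DecidableEq n]
    [DecidableEq n'] (e : n ≃ n') (x : Matrix n n ℂ) :
    (Matrix.reindexAlgEquiv ℂ ℂ e x).trace = x.trace := by
  rw [Matrix.coe_reindexAlgEquiv, Matrix.trace, Matrix.trace, ← e.symm.sum_comp]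
  rfl

/-! ### Compatibility with the real form su(k+1, k) -/

namespace OddSl

variable {k : ℕ}

theorem skew_two_iff (A : Matrix (Fin 2) (Fin 2) ℂ) : Aᴴ * diagOp + diagOp * A = 0 ↔
    star (A 0 0) = -A 0 0 ∧ star (A 1 1) = -A 1 1 ∧ star (A 0 1) = A 1 0 := by
  rw [diagOp, ← Matrix.ext_iff]
  simp only [Fin.forall_fin_two, Matrix.add_apply, Matrix.mul_diagonal, Matrix.diagonal_mul,
    Matrix.conjTranspose_apply, Matrix.zero_apply, Matrix.cons_val_zero, Matrix.cons_val_one,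
    mul_one, one_mul, mul_neg, neg_mul]
  constructor
  · rintro ⟨⟨h1, -⟩, h2, h3⟩
    exact ⟨eq_neg_of_add_eq_zero_left h1, by linear_combination -h3, by linear_combination h2⟩
  · rintro ⟨h1, h2, h3⟩
    refine ⟨⟨by rw [h1, neg_add_cancel], ?_⟩, by rw [h3, add_neg_cancel], by rw [h2, neg_neg,
      add_neg_cancel]⟩
    rw [← h3, star_star, neg_add_cancel]

/-- These matrices are the split quaternions ℝ ⊕ su(1,1). They differ from u(1,1), described by
`skew_two_iff`, only in having real instead of imaginary scalar part, which is the change made by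
`twist`. -/
theorem quaternion_iff (A : Matrix (Fin 2) (Fin 2) ℂ) : Aᴴ * diagOp = diagOp * A.adjugate ↔
    star (A 0 0) = A 1 1 ∧ star (A 0 1) = A 1 0 := by
  rw [diagOp, ← Matrix.ext_iff, Matrix.adjugate_fin_two]
  simp only [Fin.forall_fin_two, Matrix.mul_diagonal, Matrix.diagonal_mul,
    Matrix.conjTranspose_apply, Matrix.cons_val_zero, Matrix.cons_val_one, Matrix.of_apply,
    Matrix.cons_val', Matrix.cons_val_fin_one, mul_one, one_mul, mul_neg, neg_mul, neg_inj, neg_neg]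
  constructor
  · rintro ⟨⟨h1, -⟩, h2, -⟩
    exact ⟨h1, h2⟩
  · rintro ⟨h1, h2⟩
    exact ⟨⟨h1, by rw [← h2, star_star]⟩, h2, by rw [← h1, star_star]⟩

/-- The diagonal entries of the Hermitian form. -/
def sign : Idx k → ℂ
  | .inl (_, a) => ![1, -1] a
  | .inr _ => 1

/-- The matrix is skew-adjoint for the Hermitian form with diagonal entries `sign`. -/
def IsSkew (x : Matrix (Idx k) (Idx k) ℂ) : Prop :=
  ∀ p q, star (x q p) * sign q + sign p * x p q = 0

/-- The counterpart of `IsSkew` on the level of blocks. -/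
structure IsSkewBlocks (X : Blocks k) : Prop where
  off_diag : ∀ i j, i ≠ j → (X.1 j i)ᴴ * diagOp + diagOp * X.1 i j = 0
  diag : ∀ i, (X.1 i i)ᴴ * diagOp = diagOp * (X.1 i i).adjugate
  vec : ∀ i, star (X.2.2 i) = -(diagOp *ᵥ X.2.1 i)

theorem IsSkew.toBlocks {x : Matrix (Idx k) (Idx k) ℂ} (hx : IsSkew x) :
    IsSkewBlocks (toBlocks x) := by
  have hb (i j : Fin k) : (block x j i)ᴴ * diagOp + diagOp * block x i j = 0 := by
    ext a b
    rw [diagOp, Matrix.add_apply, Matrix.mul_diagonal, Matrix.diagonal_mul]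
    exact hx (.inl (i, a)) (.inl (j, b))
  have hh (i : Fin k) : star (halfTrace (block x) i) = -halfTrace (block x) i := by
    have h := (skew_two_iff _).1 (hb i i)
    rw [halfTrace, Matrix.trace_fin_two, star_div₀, star_add, h.1, h.2.1, star_ofNat]
    ring
  have e1 : (OddSl.toBlocks x).1 = shift (block x) (twist (halfTrace (block x))) := rfl
  constructor
  · intro i j h
    rw [e1, shift_of_ne _ _ h, shift_of_ne _ _ h.symm, hb]
  · intro i
    obtain ⟨h1, h2, h3⟩ := (skew_two_iff _).1 (hb i i)
    rw [e1, shift_self, quaternion_iff]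
    have h4 := star_twist hh i
    have h5 := hh i
    generalize twist (halfTrace (block x)) i = c at *
    simp only [Matrix.add_apply, Matrix.smul_apply, smul_eq_mul, star_add, star_mul', star_sub, h1,
      h3, h4, h5, Matrix.one_apply_eq, star_one]
    refine ⟨?_, by simp⟩
    rw [halfTrace, Matrix.trace_fin_two]
    ring
  · intro i
    funext a
    have := hx (.inl (i, a)) (.inr ())
    rw [diagOp, Pi.neg_apply, Matrix.mulVec_diagonal]
    refine eq_neg_of_add_eq_zero_left (Eq.trans ?_ this)
    exact congrArg (· + _) (mul_one _).symm

theorem IsSkewBlocks.ofBlocks {X : Blocks k} (hX : IsSkewBlocks X) : IsSkew (ofBlocks X) := by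
  have hh (i : Fin k) : star (halfTrace X.1 i) = halfTrace X.1 i := by
    have h := (quaternion_iff _).1 (hX.diag i)
    rw [halfTrace, Matrix.trace_fin_two, star_div₀, star_add, h.1, ← h.1, star_star, star_ofNat,
      add_comm]
  have hu := star_untwist hh
  have hb (i j : Fin k) : (block (OddSl.ofBlocks X) j i)ᴴ * diagOp +
      diagOp * block (OddSl.ofBlocks X) i j = 0 := by
    rw [block_ofBlocks]
    rcases eq_or_ne i j with rfl | h
    · obtain ⟨h1, h3⟩ := (quaternion_iff _).1 (hX.diag i)
      have h2 : star (X.1 i i 1 1) = X.1 i i 0 0 := by rw [← h1, star_star]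
      rw [shift_self, skew_two_iff]
      have h4 := hu i
      have h5 := hh i
      generalize untwist (halfTrace X.1) i = c at *
      simp only [Matrix.add_apply, Matrix.smul_apply, smul_eq_mul, star_add, star_mul', star_sub,
        h1, h2, h3, h4, h5, Matrix.one_apply_eq, star_one]
      refine ⟨?_, ?_, by simp⟩ <;>
      · rw [halfTrace, Matrix.trace_fin_two]
        ring
    · rw [shift_of_ne _ _ h, shift_of_ne _ _ h.symm, hX.off_diag i j h]
  have hv (i : Fin k) (a : Fin 2) : star (X.2.2 i a) = -(![1, -1] a * X.2.1 i a) := by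
    have := congrFun (hX.vec i) a
    rwa [diagOp, Pi.neg_apply, Matrix.mulVec_diagonal] at this
  rintro (⟨i, a⟩ | p) (⟨j, b⟩ | q)
  · have := congrFun₂ (hb i j) a b
    rwa [diagOp, Matrix.add_apply, Matrix.mul_diagonal, Matrix.diagonal_mul] at this
  · change star (X.2.2 i a) * 1 + ![1, -1] a * X.2.1 i a = 0
    rw [hv, mul_one, neg_add_cancel]
  · change star (X.2.1 j b) * ![1, -1] b + 1 * X.2.2 j b = 0
    rw [one_mul, ← star_star (X.2.2 j b), hv]
    fin_cases b <;> simp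
  · change star (-2 * ∑ i, untwist (halfTrace X.1) i) * 1 +
      1 * (-2 * ∑ i, untwist (halfTrace X.1) i) = 0
    rw [star_mul', star_sum]
    simp only [hu, Finset.sum_neg_distrib, star_neg, star_ofNat]
    ring

/-- The two hypotheses on B say that B lies in su(1,1). For `diagOp` itself the second one fails,
hence the factor i in `complexOp`. -/
theorem IsSkewBlocks.blockAct {X : Blocks k} (hX : IsSkewBlocks X) {B : Matrix (Fin 2) (Fin 2) ℂ}
    (hB : B.adjugate = -B) (hB' : Bᴴ * diagOp = -(diagOp * B)) :
    IsSkewBlocks (blockAct B X) := by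
  constructor
  · intro i j h
    have h0 := hX.off_diag i j h
    rcases lt_or_gt_of_ne h with h | h
    · simp only [OddSl.blockAct, LinearMap.coe_mk, AddHom.coe_mk, if_pos h.le, if_neg h.not_ge, hB]
      rw [Matrix.mul_neg, Matrix.conjTranspose_neg, Matrix.conjTranspose_mul, Matrix.neg_mul,
        Matrix.mul_assoc, eq_neg_of_add_eq_zero_left h0, Matrix.mul_neg, neg_neg,
        ← Matrix.mul_assoc, hB', Matrix.neg_mul, Matrix.mul_assoc, neg_add_cancel]
    · simp only [OddSl.blockAct, LinearMap.coe_mk, AddHom.coe_mk, if_pos h.le, if_neg h.not_ge, hB]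
      rw [Matrix.conjTranspose_mul, Matrix.mul_assoc, hB', Matrix.mul_neg, ← Matrix.mul_assoc,
        eq_neg_of_add_eq_zero_left h0, Matrix.neg_mul, neg_neg, Matrix.mul_neg, Matrix.mul_neg,
        Matrix.mul_assoc, add_neg_cancel]
  · intro i
    simp only [OddSl.blockAct, LinearMap.coe_mk, AddHom.coe_mk, if_pos le_rfl]
    rw [Matrix.conjTranspose_mul, Matrix.mul_assoc, hB', Matrix.adjugate_mul_distrib, hB,
      Matrix.mul_neg, Matrix.mul_neg, ← Matrix.mul_assoc, hX.diag, Matrix.mul_neg, Matrix.mul_assoc]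
  · intro i
    simp only [OddSl.blockAct, LinearMap.coe_mk, AddHom.coe_mk, hB]
    rw [Matrix.star_vecMul, hX.vec, Matrix.conjTranspose_neg, Matrix.neg_mulVec, Matrix.mulVec_neg,
      neg_neg, Matrix.mulVec_mulVec, hB', Matrix.neg_mulVec, Matrix.mulVec_mulVec]

theorem IsSkew.act {x : Matrix (Idx k) (Idx k) ℂ} (hx : IsSkew x) {B : Matrix (Fin 2) (Fin 2) ℂ}
    (hB : B.adjugate = -B) (hB' : Bᴴ * diagOp = -(diagOp * B)) : IsSkew (act B x) :=
  (hx.toBlocks.blockAct hB hB').ofBlocks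

theorem IsSkew.act_swapOp {x : Matrix (Idx k) (Idx k) ℂ} (hx : IsSkew x) :
    IsSkew (OddSl.act swapOp x) := by
  refine hx.act adjugate_swapOp ?_
  rw [diagOp_eq, swapOp]
  ext a b
  fin_cases a <;> fin_cases b <;>
  simp [Matrix.mul_apply, Fin.sum_univ_two]

theorem IsSkew.act_complexOp {x : Matrix (Idx k) (Idx k) ℂ} (hx : IsSkew x) :
    IsSkew (OddSl.act complexOp x) := by
  refine hx.act adjugate_complexOp ?_
  rw [complexOp, diagOp_eq]
  ext a b
  fin_cases a <;> fin_cases b <;>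
  simp [Matrix.mul_apply, Fin.sum_univ_two]

/-- The indices in the order of the standard Hermitian form. -/
def toSum : Idx k → Fin (k + 1) ⊕ Fin k
  | .inl (i, a) => if a = 0 then .inl i.castSucc else .inr i
  | .inr _ => .inl (Fin.last k)

theorem toSum_injective : Function.Injective (toSum (k := k)) := by
  rintro (⟨i, a⟩ | p) (⟨j, b⟩ | q) h
  · fin_cases a <;> fin_cases b <;> simp [toSum] at h ⊢ <;> exact h
  · fin_cases a <;> simp [toSum, (Fin.castSucc_lt_last _).ne] at h
  · fin_cases b <;> simp [toSum, (Fin.castSucc_lt_last _).ne'] at h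
  · rfl

theorem toSum_bijective : Function.Bijective (toSum (k := k)) := by
  refine (Fintype.bijective_iff_injective_and_card _).2 ⟨toSum_injective, ?_⟩
  simp
  ring

/-- The algebra isomorphism induced by `toSum`. -/
def sumEquiv : Matrix (Fin (k + 1) ⊕ Fin k) (Fin (k + 1) ⊕ Fin k) ℂ ≃ₐ[ℂ]
    Matrix (Idx k) (Idx k) ℂ :=
  Matrix.reindexAlgEquiv ℂ ℂ (Equiv.ofBijective toSum toSum_bijective).symm

/-- The first members of the k pairs and the single index carry the k+1 positive signs, the second
members the k negative ones. -/
theorem isSkew_sumEquiv_iff (x : Matrix (Fin (k + 1) ⊕ Fin k) (Fin (k + 1) ⊕ Fin k) ℂ) :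
    IsSkew (sumEquiv x) ↔ xᴴ * signatureForm (k + 1) k + signatureForm (k + 1) k * x = 0 := by
  have hs (p : Idx k) : Sum.elim (fun _ => 1) (fun _ => -1) (toSum p) = sign p := by
    rcases p with ⟨i, a⟩ | p
    · fin_cases a <;> simp [toSum, sign]
    · simp [toSum, sign]
  have hx (p q : Idx k) : sumEquiv x p q = x (toSum p) (toSum q) := rfl
  rw [signatureForm, LieAlgebra.Orthogonal.indefiniteDiagonal, ← Matrix.ext_iff]
  simp only [Matrix.add_apply, Matrix.mul_diagonal, Matrix.diagonal_mul, Matrix.conjTranspose_apply,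
    Matrix.zero_apply, IsSkew, ← hs, hx]
  rw [toSum_bijective.surjective.forall₂]

end OddSl

theorem exists_isTracelessComplexProduct {n : Type*} [Fintype n] [DecidableEq n] {k : ℕ}
    (hn : Fintype.card n = 2 * k + 1) :
    ∃ P J : Matrix n n ℂ →ₗ[ℂ] Matrix n n ℂ, IsTracelessComplexProduct P J := by
  have e : n ≃ OddSl.Idx k := Fintype.equivOfCardEq (by
    rw [hn]
    simp
    ring)
  exact ⟨_, _, OddSl.isTracelessComplexProduct.conj (Matrix.reindexAlgEquiv ℂ ℂ e)
    (trace_reindexAlgEquiv e)⟩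

theorem exists_isTracelessComplexProduct_su (k : ℕ) :
    ∃ P J : Matrix (Fin (k + 1) ⊕ Fin k) (Fin (k + 1) ⊕ Fin k) ℂ →ₗ[ℂ]
        Matrix (Fin (k + 1) ⊕ Fin k) (Fin (k + 1) ⊕ Fin k) ℂ,
      IsTracelessComplexProduct P J ∧
      (∀ x, xᴴ * signatureForm (k + 1) k + signatureForm (k + 1) k * x = 0 →
        (P x)ᴴ * signatureForm (k + 1) k + signatureForm (k + 1) k * P x = 0) ∧
      ∀ x, xᴴ * signatureForm (k + 1) k + signatureForm (k + 1) k * x = 0 →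
        (J x)ᴴ * signatureForm (k + 1) k + signatureForm (k + 1) k * J x = 0 := by
  refine ⟨_, _, OddSl.isTracelessComplexProduct.conj OddSl.sumEquiv
    (trace_reindexAlgEquiv _), fun x hx => ?_, fun x hx => ?_⟩
  · rw [← OddSl.isSkew_sumEquiv_iff] at hx ⊢
    exact (congrArg OddSl.IsSkew (OddSl.sumEquiv.apply_symm_apply
      (OddSl.act OddSl.swapOp (OddSl.sumEquiv x)))).mpr hx.act_swapOp
  · rw [← OddSl.isSkew_sumEquiv_iff] at hx ⊢
    exact (congrArg OddSl.IsSkew (OddSl.sumEquiv.apply_symm_apply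
      (OddSl.act OddSl.complexOp (OddSl.sumEquiv x)))).mpr hx.act_complexOp

/-! ### The Killing forms -/

/-- In the real basis formed by b and ib, each complex diagonal entry contributes its real part
twice. -/
theorem LinearMap.trace_restrictScalars_complex {V ι : Type*} [AddCommGroup V] [Module ℂ V]
    [Module ℝ V] [IsScalarTower ℝ ℂ V] [Fintype ι] [DecidableEq ι] (b : Module.Basis ι ℂ V)
    (f : V →ₗ[ℂ] V) :
    LinearMap.trace ℝ V (f.restrictScalars ℝ) = 2 * (LinearMap.trace ℂ V f).re := by
  rw [LinearMap.trace_eq_matrix_trace ℂ b, LinearMap.trace_eq_matrix_trace ℝ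
    (Complex.basisOneI.smulTower b), Matrix.trace, Matrix.trace, Fintype.sum_prod_type,
    Fin.sum_univ_two, Complex.re_sum, two_mul]
  congr 1
  · refine Finset.sum_congr rfl fun j _ => ?_
    simp [LinearMap.toMatrix_apply, Module.Basis.smulTower_repr, Module.Basis.smulTower_apply]
  · refine Finset.sum_congr rfl fun j _ => ?_
    simp [LinearMap.toMatrix_apply, Module.Basis.smulTower_repr, Module.Basis.smulTower_apply]

/-! ### Traces of compositions of inner derivations -/

section Matrices

variable {n : Type*} [Fintype n]

/-- The conjugate-linear automorphism `z ↦ -η zᴴ η`. -/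
def skewInvolution (η : Matrix n n ℂ) : Matrix n n ℂ →ₗ[ℝ] Matrix n n ℂ where
  toFun z := -(η * zᴴ * η)
  map_add' z w := by
    rw [Matrix.conjTranspose_add, Matrix.mul_add, Matrix.add_mul, neg_add]
  map_smul' c z := by
    rw [Matrix.conjTranspose_smul, star_trivial, Matrix.mul_smul, Matrix.smul_mul, smul_neg,
      RingHom.id_apply]

theorem skewInvolution_mul_I (η z : Matrix n n ℂ) :
    skewInvolution η (Complex.I • z) = -(Complex.I • skewInvolution η z) := by
  change -(η * (Complex.I • z)ᴴ * η) = -(Complex.I • -(η * zᴴ * η))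
  rw [Matrix.conjTranspose_smul, Complex.star_def, Complex.conj_I, Matrix.mul_smul,
    Matrix.smul_mul, smul_neg, neg_smul]

theorem eq_zero_of_trace_mul_conjTranspose {v : Matrix n n ℂ} (h : (v * vᴴ).trace.re = 0) :
    v = 0 := by
  have h1 : (v * vᴴ).trace.re = ∑ i, ∑ j, Complex.normSq (v i j) := by
    simp only [Matrix.trace, Matrix.diag_apply, Matrix.mul_apply, Matrix.conjTranspose_apply,
      Complex.re_sum, Complex.star_def, Complex.mul_conj, Complex.ofReal_re]
  ext i j
  have h2 := (Finset.sum_eq_zero_iff_of_nonneg fun i _ =>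
    Finset.sum_nonneg fun j _ => Complex.normSq_nonneg (v i j)).1 (h1.symm.trans h) i
      (Finset.mem_univ i)
  exact Complex.normSq_eq_zero.1 ((Finset.sum_eq_zero_iff_of_nonneg fun j _ =>
    Complex.normSq_nonneg (v i j)).1 h2 j (Finset.mem_univ j))

/-- The composite anticommutes with multiplication by i; cyclicity of the trace then makes its trace
equal to its own negative. -/
theorem trace_comp_eq_zero_of_antilinear (f : Matrix n n ℂ →ₗ[ℂ] Matrix n n ℂ)
    (σ : Matrix n n ℂ →ₗ[ℝ] Matrix n n ℂ) (hσ : ∀ z, σ (Complex.I • z) = -(Complex.I • σ z)) :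
    LinearMap.trace ℝ _ (f.restrictScalars ℝ ∘ₗ σ) = 0 := by
  let i : Matrix n n ℂ →ₗ[ℝ] Matrix n n ℂ :=
    (Complex.I • (LinearMap.id : Matrix n n ℂ →ₗ[ℂ] Matrix n n ℂ)).restrictScalars ℝ
  have h1 : i ∘ₗ ((f.restrictScalars ℝ ∘ₗ σ) ∘ₗ i) = f.restrictScalars ℝ ∘ₗ σ := by
    ext1 z
    change Complex.I • f (σ (Complex.I • z)) = f (σ z)
    rw [hσ, map_neg, map_smul, smul_neg, smul_smul, Complex.I_mul_I, neg_one_smul, neg_neg]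
  have h2 : ((f.restrictScalars ℝ ∘ₗ σ) ∘ₗ i) ∘ₗ i = -(f.restrictScalars ℝ ∘ₗ σ) := by
    ext1 z
    change f (σ (Complex.I • Complex.I • z)) = -f (σ z)
    rw [smul_smul, Complex.I_mul_I, neg_one_smul, map_neg, map_neg]
  have h3 : LinearMap.trace ℝ _ (f.restrictScalars ℝ ∘ₗ σ) =
      -LinearMap.trace ℝ _ (f.restrictScalars ℝ ∘ₗ σ) := by
    rw [← map_neg, ← h2, LinearMap.trace_comp_comm' i, h1]
  exact self_eq_neg.1 h3

variable [DecidableEq n]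

/-- Multiplication by `a` from the left and by `b` from the right. -/
def Matrix.mulLeftRight (a b : Matrix n n ℂ) : Matrix n n ℂ →ₗ[ℂ] Matrix n n ℂ :=
  LinearMap.mulLeft ℂ a ∘ₗ LinearMap.mulRight ℂ b

/-- The coefficient of the matrix unit E i j in a (E i j) b is a i i * b j j. -/
theorem Matrix.trace_mulLeftRight (a b : Matrix n n ℂ) :
    LinearMap.trace ℂ _ (mulLeftRight a b) = a.trace * b.trace := by
  rw [LinearMap.trace_eq_matrix_trace ℂ (Matrix.stdBasis ℂ n n), Matrix.trace, Matrix.trace,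
    Matrix.trace, Fintype.sum_prod_type, Finset.sum_mul_sum]
  refine Finset.sum_congr rfl fun i _ => Finset.sum_congr rfl fun j _ => ?_
  rw [Matrix.diag_apply, LinearMap.toMatrix_apply, Matrix.stdBasis_eq_single]
  change (a * (Matrix.single i j 1 * b) : Matrix n n ℂ) i j = _
  simp [Matrix.mul_apply, Matrix.single_apply, ite_and]

/-- The composition of two inner derivations of the matrix algebra. -/
def adAd (v w : Matrix n n ℂ) : Matrix n n ℂ →ₗ[ℂ] Matrix n n ℂ :=
  Matrix.mulLeftRight (v * w) 1 - Matrix.mulLeftRight v w - Matrix.mulLeftRight w v +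
    Matrix.mulLeftRight 1 (w * v)

theorem adAd_apply (v w z : Matrix n n ℂ) :
    adAd v w z = v * (w * z - z * w) - (w * z - z * w) * v := by
  change v * w * (z * 1) - v * (z * w) - w * (z * v) + 1 * (z * (w * v)) = _
  noncomm_ring

theorem trace_adAd_apply (v w z : Matrix n n ℂ) : (adAd v w z).trace = 0 := by
  rw [adAd_apply, Matrix.trace_sub, Matrix.trace_mul_comm, sub_self]

/-- The mixed terms contain tr v and vanish; the other two give 2n tr(vw) over ℂ, and restriction to
ℝ doubles the real part. -/
theorem trace_adAd {v w : Matrix n n ℂ} (hv : v.trace = 0) :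
    LinearMap.trace ℝ _ ((adAd v w).restrictScalars ℝ) =
      4 * Fintype.card n * (v * w).trace.re := by
  rw [LinearMap.trace_restrictScalars_complex (Matrix.stdBasis ℂ n n), adAd, map_add, map_sub,
    map_sub, Matrix.trace_mulLeftRight, Matrix.trace_mulLeftRight, Matrix.trace_mulLeftRight,
    Matrix.trace_mulLeftRight, hv, Matrix.trace_one, Matrix.trace_mul_comm w v]
  simp
  ring

theorem trace_eq_of_forall_adAd {v w : Matrix n n ℂ} (hv : v.trace = 0)
    {W : Submodule ℝ (Matrix n n ℂ)} (hW : ∀ z, z ∈ W ↔ z.trace = 0) (f : W →ₗ[ℝ] W)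
    (hf : ∀ z : W, (f z : Matrix n n ℂ) = v * (w * z - z * w) - (w * z - z * w) * v) :
    LinearMap.trace ℝ W f = 4 * Fintype.card n * (v * w).trace.re := by
  rw [← trace_adAd hv, ← LinearMap.trace_restrict_eq_of_forall_mem W
    ((adAd v w).restrictScalars ℝ) fun z => (hW _).2 (trace_adAd_apply v w z)]
  congr 1
  ext1 z
  exact Subtype.ext ((hf z).trans (adAd_apply v w z).symm)

theorem skewInvolution_commutator {η : Matrix n n ℂ} (hη : η * η = 1) (v w : Matrix n n ℂ) :
    skewInvolution η (v * w - w * v) =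
      skewInvolution η v * skewInvolution η w - skewInvolution η w * skewInvolution η v := by
  have h (a b : Matrix n n ℂ) :
      skewInvolution η a * skewInvolution η b = η * (aᴴ * bᴴ) * η := by
    change -(η * aᴴ * η) * -(η * bᴴ * η) = _
    rw [neg_mul_neg]
    calc η * aᴴ * η * (η * bᴴ * η) = η * aᴴ * (η * η) * bᴴ * η := by simp only [Matrix.mul_assoc]
      _ = _ := by rw [hη, Matrix.mul_one, Matrix.mul_assoc η]
  rw [h, h]
  change -(η * (v * w - w * v)ᴴ * η) = _
  rw [Matrix.conjTranspose_sub, Matrix.conjTranspose_mul, Matrix.conjTranspose_mul,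
    ← Matrix.sub_mul, ← Matrix.mul_sub, ← Matrix.neg_mul, ← Matrix.mul_neg, neg_sub]

/-- W is the trace-free part of the real form fixed by the conjugate-linear involution σ, a Lie
algebra automorphism that commutes with F = ad v ∘ ad w. The map ½(F + Fσ) has image in W and
restricts to F there, so its trace on all matrices is the wanted one. The antilinear term Fσ has
trace zero, which leaves half the trace of F. -/
theorem trace_eq_of_forall_adAd_of_skew {v w η : Matrix n n ℂ} (hη : η * η = 1) (hη' : ηᴴ = η)
    {W : Submodule ℝ (Matrix n n ℂ)}
    (hW : ∀ z, z ∈ W ↔ skewInvolution η z = z ∧ z.trace = 0) (hv : v ∈ W) (hw : w ∈ W)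
    (f : W →ₗ[ℝ] W)
    (hf : ∀ z : W, (f z : Matrix n n ℂ) = v * (w * z - z * w) - (w * z - z * w) * v) :
    LinearMap.trace ℝ W f = 2 * Fintype.card n * (v * w).trace.re := by
  obtain ⟨hv, hv0⟩ := (hW v).1 hv
  have hw := ((hW w).1 hw).1
  let F := (adAd v w).restrictScalars ℝ
  let σ := skewInvolution η
  have hσσ (z : Matrix n n ℂ) : σ (σ z) = z := by
    change -(η * (-(η * zᴴ * η))ᴴ * η) = z
    rw [Matrix.conjTranspose_neg, Matrix.conjTranspose_mul, Matrix.conjTranspose_mul,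
      Matrix.conjTranspose_conjTranspose, hη', Matrix.mul_neg, Matrix.neg_mul, neg_neg]
    calc η * (η * (z * η)) * η = (η * η) * z * (η * η) := by simp only [Matrix.mul_assoc]
      _ = z := by rw [hη, Matrix.one_mul, Matrix.mul_one]
  have hσF (z : Matrix n n ℂ) : σ (F z) = F (σ z) := by
    change σ (adAd v w z) = adAd v w (σ z)
    rw [adAd_apply, adAd_apply, skewInvolution_commutator hη, skewInvolution_commutator hη, hv,
      hw]
  let H : Matrix n n ℂ →ₗ[ℝ] Matrix n n ℂ := (1 / 2 : ℝ) • (F + F ∘ₗ σ)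
  have hH (z : Matrix n n ℂ) : H z = (1 / 2 : ℝ) • (F z + F (σ z)) := rfl
  have hHW (z : Matrix n n ℂ) : H z ∈ W := by
    refine (hW _).2 ⟨?_, ?_⟩
    · change σ (H z) = H z
      rw [hH, map_smul, map_add, hσF, hσF, hσσ, add_comm]
    · rw [hH, Matrix.trace_smul, Matrix.trace_add]
      change (1 / 2 : ℝ) • ((adAd v w z).trace + (adAd v w (σ z)).trace) = 0
      rw [trace_adAd_apply, trace_adAd_apply, add_zero, smul_zero]
  have hfH : f = H.restrict fun z _ => hHW z := by
    ext1 z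
    refine Subtype.ext ?_
    change (f z : Matrix n n ℂ) = H z
    have hz : σ z = z := ((hW z).1 z.2).1
    rw [hH, hz, ← two_smul ℝ, smul_smul, hf, ← adAd_apply]
    norm_num
    rfl
  rw [hfH, LinearMap.trace_restrict_eq_of_forall_mem W H hHW, map_smul, map_add,
    trace_comp_eq_zero_of_antilinear _ _ (skewInvolution_mul_I η), trace_adAd hv0, smul_eq_mul]
  ring

variable (n) in
/-- A multiple of the real part of the trace. -/
def reTrace (c : ℝ) : Matrix n n ℂ →ₗ[ℝ] ℝ :=
  c • Complex.reLm ∘ₗ (Matrix.traceLinearMap n ℂ ℂ).restrictScalars ℝ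

end Matrices

/-! ### The two families of groups -/

section Groups

variable {n : Type*} [Fintype n] [DecidableEq n]

theorem slReal.exists_killingMetric_complexProduct {P J : Matrix n n ℂ →ₗ[ℂ] Matrix n n ℂ}
    (h : IsTracelessComplexProduct P J) (hn : Fintype.card n ≠ 0) :
    ∃ g : PseudoRiemannianMetric 𝓘(ℝ, slReal n) (Matrix.SpecialLinearGroup n ℂ),
      g.IsKillingMetric ∧
      ∃ P J : EndomorphismField 𝓘(ℝ, slReal n) (Matrix.SpecialLinearGroup n ℂ),
        IsComplexProductStructure P J ∧ P.IsLeftInvariant ∧ J.IsLeftInvariant ∧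
          g.IsCompatible P J := by
  have hn' : (4 * Fintype.card n : ℝ) ≠ 0 := by positivity
  refine (slRealLinear n).exists_killingMetric_complexProduct (reTrace n (4 * Fintype.card n))
    ?_ ?_ ?_ (P.restrictScalars ℝ) (J.restrictScalars ℝ) ?_ ?_ ?_ ?_ ?_ ?_ ?_ ?_ ?_
  · exact fun a b => congrArg (fun z : ℂ => 4 * Fintype.card n * z.re)
      (Matrix.trace_mul_comm (n := n) a b)
  · exact fun v hv w _ f hf => trace_eq_of_forall_adAd (n := n) hv (fun _ => Iff.rfl) f hf
  · intro v hv hw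
    refine eq_zero_of_trace_mul_conjTranspose (n := n) ?_
    -- Nondegeneracy: pairing v with its conjugate transpose, again trace-free, gives a nonzero
    -- multiple of the sum of the |v i j|².
    refine (mul_eq_zero.1 (hw (Matrix.conjTranspose (m := n) v) ?_)).resolve_left hn'
    refine (Matrix.trace_conjTranspose (n := n) v).trans ?_
    exact (congrArg star hv).trans (star_zero ℂ)
  · exact fun v _ => h.trace_product v
  · exact fun v _ => h.trace_complex v
  · exact fun v hv => h.product_sq v hv
  · exact fun v hv => h.complex_sq v hv
  · exact fun v hv => h.anticomm v hv
  · exact fun v hv w hw => h.nijenhuis_product v w hv hw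
  · exact fun v hv w hw => h.nijenhuis_complex v w hv hw
  · intro v hv w hw
    have := congrArg (fun z : ℂ => 4 * Fintype.card n * z.re) (h.trace_product_mul v w hv hw)
    exact this.trans (mul_neg _ _)
  · exact fun v hv w hw => congrArg (fun z : ℂ => 4 * Fintype.card n * z.re)
      (h.trace_complex_mul v w hv hw)

/-- Closure of su(p, q) under the conjugate transpose permits the same nondegeneracy argument as for
SL, although the trace form is indefinite. -/
theorem skew_conjTranspose {p q : ℕ} {X : Matrix (Fin p ⊕ Fin q) (Fin p ⊕ Fin q) ℂ}
    (hX : Xᴴ * signatureForm p q + signatureForm p q * X = 0) :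
    Xᴴᴴ * signatureForm p q + signatureForm p q * Xᴴ = 0 := by
  have h := (skew_iff X).2 hX
  rw [Matrix.conjTranspose_conjTranspose, ← sub_neg_eq_add, sub_eq_zero]
  calc X * signatureForm p q = -(signatureForm p q * Xᴴ * signatureForm p q) * signatureForm p q := by
        rw [h, neg_neg]
    _ = _ := by rw [Matrix.neg_mul, Matrix.mul_assoc, signatureForm_mul_self, Matrix.mul_one]

theorem suReal.exists_killingMetric_complexProduct {p q : ℕ}
    {P J : Matrix (Fin p ⊕ Fin q) (Fin p ⊕ Fin q) ℂ →ₗ[ℂ] Matrix (Fin p ⊕ Fin q) (Fin p ⊕ Fin q) ℂ}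
    (h : IsTracelessComplexProduct P J)
    (hP : ∀ x, xᴴ * signatureForm p q + signatureForm p q * x = 0 →
        (P x)ᴴ * signatureForm p q + signatureForm p q * P x = 0)
    (hJ : ∀ x, xᴴ * signatureForm p q + signatureForm p q * x = 0 →
        (J x)ᴴ * signatureForm p q + signatureForm p q * J x = 0)
    (hn : Fintype.card (Fin p ⊕ Fin q) ≠ 0) :
    ∃ g : PseudoRiemannianMetric 𝓘(ℝ, suReal p q) (SU p q), g.IsKillingMetric ∧
      ∃ P J : EndomorphismField 𝓘(ℝ, suReal p q) (SU p q),
        IsComplexProductStructure P J ∧ P.IsLeftInvariant ∧ J.IsLeftInvariant ∧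
          g.IsCompatible P J := by
  have hn' : (2 * Fintype.card (Fin p ⊕ Fin q) : ℝ) ≠ 0 := by positivity
  have hs := signatureForm_mul_self p q
  have hsc : (signatureForm p q)ᴴ = signatureForm p q := by
    rw [signatureForm, LieAlgebra.Orthogonal.indefiniteDiagonal, Matrix.diagonal_conjTranspose]
    congr 1
    funext i
    cases i <;> simp
  refine (suLinear p q).exists_killingMetric_complexProduct
    (reTrace (Fin p ⊕ Fin q) (2 * Fintype.card (Fin p ⊕ Fin q)))
    ?_ ?_ ?_ (P.restrictScalars ℝ) (J.restrictScalars ℝ) ?_ ?_ ?_ ?_ ?_ ?_ ?_ ?_ ?_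
  · exact fun a b => congrArg (fun z : ℂ => 2 * Fintype.card (Fin p ⊕ Fin q) * z.re)
      (Matrix.trace_mul_comm (n := Fin p ⊕ Fin q) a b)
  · refine fun v hv w hw f hf => trace_eq_of_forall_adAd_of_skew (n := Fin p ⊕ Fin q) hs hsc
      (fun z => ?_) hv hw f hf
    refine and_congr_left' ((skew_iff z).symm.trans ?_)
    exact neg_eq_iff_eq_neg.symm
  · intro v hv hw
    refine eq_zero_of_trace_mul_conjTranspose (n := Fin p ⊕ Fin q) ?_
    refine (mul_eq_zero.1 (hw (Matrix.conjTranspose (m := Fin p ⊕ Fin q) v) ⟨?_, ?_⟩)).resolve_left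
      hn'
    · exact skew_conjTranspose hv.1
    · refine (Matrix.trace_conjTranspose (n := Fin p ⊕ Fin q) v).trans ?_
      exact (congrArg star hv.2).trans (star_zero ℂ)
  · exact fun v hv => ⟨hP v hv.1, h.trace_product v⟩
  · exact fun v hv => ⟨hJ v hv.1, h.trace_complex v⟩
  · exact fun v hv => h.product_sq v hv.2
  · exact fun v hv => h.complex_sq v hv.2
  · exact fun v hv => h.anticomm v hv.2
  · exact fun v hv w hw => h.nijenhuis_product v w hv.2 hw.2
  · exact fun v hv w hw => h.nijenhuis_complex v w hv.2 hw.2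
  · intro v hv w hw
    have := congrArg (fun z : ℂ => 2 * Fintype.card (Fin p ⊕ Fin q) * z.re)
      (h.trace_product_mul v w hv.2 hw.2)
    exact this.trans (mul_neg _ _)
  · exact fun v hv w hw => congrArg (fun z : ℂ => 2 * Fintype.card (Fin p ⊕ Fin q) * z.re)
      (h.trace_complex_mul v w hv.2 hw.2)

end Groups

end

theorem theorem1p4 (m : ℕ) (hm : 1 < m) :
    (∃ g : PseudoRiemannianMetric 𝓘(ℝ, suReal m (m - 1)) (SU m (m - 1)), g.IsKillingMetric ∧
      ∃ P J : EndomorphismField 𝓘(ℝ, suReal m (m - 1)) (SU m (m - 1)),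
        IsComplexProductStructure P J ∧ P.IsLeftInvariant ∧ J.IsLeftInvariant ∧
          g.IsCompatible P J) ∧
    (∃ g : PseudoRiemannianMetric 𝓘(ℝ, slReal (Fin (2 * m - 1)))
        (Matrix.SpecialLinearGroup (Fin (2 * m - 1)) ℂ), g.IsKillingMetric ∧
      ∃ P J : EndomorphismField 𝓘(ℝ, slReal (Fin (2 * m - 1)))
          (Matrix.SpecialLinearGroup (Fin (2 * m - 1)) ℂ),
        IsComplexProductStructure P J ∧ P.IsLeftInvariant ∧ J.IsLeftInvariant ∧
          g.IsCompatible P J) := by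
  constructor
  · obtain ⟨k, rfl⟩ : ∃ k, m = k + 1 := ⟨m - 1, by omega⟩
    obtain ⟨P, J, h, hP, hJ⟩ := exists_isTracelessComplexProduct_su k
    exact suReal.exists_killingMetric_complexProduct h hP hJ (by simp)
  · obtain ⟨P, J, h⟩ := exists_isTracelessComplexProduct (n := Fin (2 * m - 1)) (k := m - 1)
      (by rw [Fintype.card_fin]; omega)
    exact slReal.exists_killingMetric_complexProduct h (by rw [Fintype.card_fin]; omega)
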